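/- Let $0\le b_1<\cdots<b_g$ be finitely many integers and let $b_1^*<b_2^*<\cdots$ be the remaining non-negative integers. (The motivating case: the gaps and non-gaps at $p_\infty$ of the degree-zero line bundle $L_{e+\delta}$ on a compact Riemann surface of genus $g$, where $e$ is a zero of Riemann's theta function and $\delta$ is Riemann's constant.) Put $\lambda=(\lambda_1,\dots,\lambda_g)=(b_g,\dots,b_1)-(g-1,\dots,1,0)$, and for $0\le k\le g$ put $$m_k=\#\{i: b_i^*<g-k\},\qquad A_k=(b_{g-k},b_{g-k-1},\dots,b_{g-k-m_k+1})-(b_1^*,\dots,b_{m_k}^*),$$ a sequence of $m_k$ positive integers, and let $c_k=\pm1$ be the sign of the permutation of $\{0,\dots,g-k-1\}$ that sends the entries of $(b_1^*,\dots,b_{m_k}^*,b_{g-k-m_k},\dots,b_1)$, in this order, to $g-k-1,\dots,1,0$. For $t=(t_1,t_2,\dots)$ define $p_n(t)$ by $\exp\bigl(\sum_{n\ge1}t_nz^n\bigr)=\sum_{n\ge0}p_n(t)z^n$, $p_n=0$ for $n<0$, and $s_{(\mu_1,\dots,\mu_l)}(t)=\det(p_{\mu_i-i+j}(t))_{1\le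 i,j\le l}$ (equal to $1$ for $l=0$). For partitions write $\lambda\le\mu$ if $\lambda_i\le\mu_i$ for all $i$. Let $\xi_\mu\in\mathbb C$ be arbitrary for $\mu>\lambda$, and consider the formal power series $$\tau(t)=s_\lambda(t)+\sum_{\mu>\lambda}\xi_\mu s_\mu(t),\qquad \tau^{(k)}(t)=s_{(\lambda_1,\dots,\lambda_k)}(t)+\sum_{\mu}\xi_\mu s_{(\mu_1,\dots,\mu_k)}(t),$$ the last sum being over the partitions $\mu=(\mu_1,\dots,\mu_g)$ with $\mu>\lambda$ and $\mu_i=\lambda_i$ for $k+1\le i\le g$ (so $\tau^{(0)}=1$). Write $[x]=(x,x^2/2,x^3/3,\dots)$ and $\partial_{t,I}=\partial_{t_{i_1}}\cdots\partial_{t_{i_m}}$ for a finite sequence $I=(i_1,\dots,i_m)$ of positive integers. Below, $x_1,x_2,\dots$ are formal variables, and $F=G+O(x_k^N)$ means that $F-G$ is divisible by $x_k^N$ as a formal power series. (A) Let $0\le k\le g-1$ with $m_k>0$. Then (i) $\displaystyle\partial_{t,A_k}\tau\Bigl(\sum_{i=1}^k[x_i]\Bigr)=c_k\,\tau^{(k)}\Bigl(\sum_{i=1}^k[x_i]\Bigr)$;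 and, if $k\ge1$, (ii) $\displaystyle\tau^{(k)}\Bigl(\sum_{i=1}^k[x_i]\Bigr)=\tau^{(k-1)}\Bigl(\sum_{i=1}^{k-1}[x_i]\Bigr)x_k^{\lambda_k}+O(x_k^{\lambda_k+1})$; (iii) $\displaystyle\partial_{t,A_k}\tau\Bigl(\sum_{i=1}^k[x_i]\Bigr)=\frac{c_k}{c_{k-1}}\,\partial_{t,A_{k-1}}\tau\Bigl(\sum_{i=1}^{k-1}[x_i]\Bigr)x_k^{\lambda_k}+O(x_k^{\lambda_k+1})$. (B) (i) $\partial_{t,I}\tau(0)=0$ for every $I=(i_1,\dots,i_m)$ with $i_1+\cdots+i_m<|\lambda|=\lambda_1+\cdots+\lambda_g$. (ii) $\partial_{t,I}\tau(0)=0$ for every $I=(i_1,\dots,i_m)$ with $m<m_0$. (iii) $\partial_{t,A_0}\tau(0)=c_0$. -/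

import Mathlib

namespace GapTau

noncomputable section

/-! ### Gaps, the partition, the a-sequence and the sign

A finite set `B` of non-negative integers plays the role of the set of gaps
`b_1 < ... < b_g`, with `g = B.card`; its complement is the set of non-gaps
`b*_1 < b*_2 < ...`.  Lean indices start at `0`. -/

/-- `gap B i` is the gap `b_{i+1}`, for `i < B.card`. -/
def gap (B : Finset ℕ) (i : ℕ) : ℕ := Nat.nth (fun n => n ∈ B) i

/-- `nongap B i` is the non-gap `b*_{i+1}`. -/
def nongap (B : Finset ℕ) (i : ℕ) : ℕ := Nat.nth (fun n => n ∉ B) i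

/-- `m_k`, the number of non-gaps smaller than `g - k`. -/
def mNum (B : Finset ℕ) (k : ℕ) : ℕ := Nat.count (fun n => n ∉ B) (B.card - k)

theorem count_add_mNum (B : Finset ℕ) (k : ℕ) :
    Nat.count (fun n => n ∈ B) (B.card - k) + mNum B k = B.card - k := by
  unfold mNum
  simp only [Nat.count_eq_card_filter_range]
  simpa using Finset.card_filter_add_card_filter_not (s := Finset.range (B.card - k))
    (fun n => n ∈ B)

theorem gap_cond {B : Finset ℕ} {i : ℕ} (hi : i < B.card) :
    ∀ hf : (Set.ofPred (fun n => n ∈ B)).Finite, i < hf.toFinset.card := by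
  intro hf
  have : hf.toFinset = B := by ext n; simp
  rwa [this]

theorem nongap_infinite (B : Finset ℕ) : (Set.ofPred (fun n => n ∉ B)).Infinite :=
  B.finite_toSet.infinite_compl

theorem gap_mem {B : Finset ℕ} {i : ℕ} (hi : i < B.card) : gap B i ∈ B :=
  Nat.nth_mem i (gap_cond hi)

theorem nongap_notMem (B : Finset ℕ) (i : ℕ) : nongap B i ∉ B :=
  Nat.nth_mem_of_infinite (nongap_infinite B) i

theorem gap_lt_gap {B : Finset ℕ} {i j : ℕ} (h : i < j) (hj : j < B.card) : gap B i < gap B j :=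
  Nat.nth_lt_nth' h (gap_cond hj)

theorem nongap_lt {B : Finset ℕ} {k i : ℕ} (hi : i < mNum B k) : nongap B i < B.card - k :=
  Nat.nth_lt_of_lt_count hi

theorem gap_lt {B : Finset ℕ} {k i : ℕ} (hi : i + mNum B k < B.card - k) :
    gap B i < B.card - k := by
  have := count_add_mNum B k
  exact Nat.nth_lt_of_lt_count (by omega)

theorem le_gap {B : Finset ℕ} {k i : ℕ} (hi : B.card - k ≤ i + mNum B k) (hi' : i < B.card) :
    B.card - k ≤ gap B i := by
  by_contra h
  have h1 : Nat.count (fun n => n ∈ B) (gap B i + 1) ≤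
      Nat.count (fun n => n ∈ B) (B.card - k) := Nat.count_monotone _ (by omega)
  have h2 : Nat.count (fun n => n ∈ B) (gap B i + 1) = i + 1 := Nat.count_nth_succ (gap_cond hi')
  have := count_add_mNum B k
  omega

/-- The parts of the partition: `lamPart B i` is `λ_{i+1} = b_{g-i} - (g-1-i)` for `i < g`, and
`0` for `i ≥ g`. -/
def lamPart (B : Finset ℕ) (i : ℕ) : ℕ :=
  if i < B.card then gap B (B.card - 1 - i) - (B.card - 1 - i) else 0

theorem lamPart_antitone (B : Finset ℕ) : Antitone (lamPart B) := by
  refine antitone_nat_of_succ_le fun i => ?_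
  unfold lamPart
  split_ifs with h1 h2
  · have := gap_lt_gap (B := B) (i := B.card - 1 - (i + 1)) (j := B.card - 1 - i)
      (by omega) (by omega)
    omega
  · omega
  · omega
  · omega

/-- The partition `λ = (b_g, ..., b_1) - (g-1, ..., 1, 0)`. -/
def lam (B : Finset ℕ) : YoungDiagram where
  cells := (Finset.range B.card).biUnion fun i =>
    (Finset.range (lamPart B i)).image fun j => (i, j)
  isLowerSet := by
    rintro ⟨i, j⟩ ⟨i', j'⟩ hle h
    obtain ⟨h1, h2⟩ : i' ≤ i ∧ j' ≤ j := hle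
    simp only [Finset.mem_coe, Finset.mem_biUnion, Finset.mem_image, Finset.mem_range,
      Prod.mk.injEq] at h ⊢
    obtain ⟨a, ha, b, hb, rfl, rfl⟩ := h
    exact ⟨i', by omega, j', by have := lamPart_antitone B h1; omega, rfl, rfl⟩

theorem rowLen_lam (B : Finset ℕ) (i : ℕ) : (lam B).rowLen i = lamPart B i := by
  have key : ∀ j, j < (lam B).rowLen i ↔ j < lamPart B i := by
    intro j
    rw [← YoungDiagram.mem_iff_lt_rowLen, ← YoungDiagram.mem_cells]
    simp only [lam, Finset.mem_biUnion, Finset.mem_image, Finset.mem_range, Prod.mk.injEq]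
    constructor
    · rintro ⟨a, ha, b, hb, rfl, rfl⟩
      exact hb
    · intro hj
      refine ⟨i, ?_, j, hj, rfl, rfl⟩
      by_contra hi
      simp [lamPart, hi] at hj
  exact le_antisymm (not_lt.1 fun h => lt_irrefl _ ((key _).1 h))
    (not_lt.1 fun h => lt_irrefl _ ((key _).2 h))

theorem aSeq_pos {B : Finset ℕ} {k i : ℕ} (hi : i < mNum B k) :
    0 < gap B (B.card - k - 1 - i) - nongap B i := by
  have h1 := nongap_lt hi
  have h2 := count_add_mNum B k
  have h3 := le_gap (B := B) (k := k) (i := B.card - k - 1 - i) (by omega) (by omega)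
  omega

/-- The a-sequence `A_k = (b_{g-k}, ..., b_{g-k-m_k+1}) - (b*_1, ..., b*_{m_k})`, a list of
positive integers of length `m_k`. -/
def aSeq (B : Finset ℕ) (k : ℕ) : List ℕ+ :=
  List.ofFn fun i : Fin (mNum B k) => ⟨gap B (B.card - k - 1 - i) - nongap B i, aSeq_pos i.2⟩

/-- The sequence `(b*_1, ..., b*_{m_k}, b_{g-k-m_k}, ..., b_1)` of length `g - k`. -/
def topRow (B : Finset ℕ) (k : ℕ) (j : ℕ) : ℕ :=
  if j < mNum B k then nongap B j else gap B (B.card - k - 1 - j)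

theorem topRow_lt {B : Finset ℕ} {k j : ℕ} (hj : j < B.card - k) : topRow B k j < B.card - k := by
  unfold topRow
  split_ifs with h
  · exact nongap_lt h
  · exact gap_lt (by omega)

theorem topRow_injective (B : Finset ℕ) (k : ℕ) :
    Function.Injective fun j : Fin (B.card - k) =>
      (⟨topRow B k j, topRow_lt j.2⟩ : Fin (B.card - k)) := by
  rintro ⟨i, hi⟩ ⟨j, hj⟩ h
  simp only [Fin.mk.injEq] at h ⊢
  unfold topRow at h
  split_ifs at h with h1 h2 h2
  · exact Nat.nth_injective (nongap_infinite B) h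
  · exact absurd (h ▸ gap_mem (by omega)) (nongap_notMem B i)
  · exact absurd (h.symm ▸ gap_mem (by omega)) (nongap_notMem B j)
  · rcases lt_trichotomy i j with hij | hij | hij
    · have := gap_lt_gap (B := B) (i := B.card - k - 1 - j) (j := B.card - k - 1 - i)
        (by omega) (by omega)
      omega
    · exact hij
    · have := gap_lt_gap (B := B) (i := B.card - k - 1 - i) (j := B.card - k - 1 - j)
        (by omega) (by omega)
      omega

/-- `topRow` as a bijection from positions to values in `{0, ..., g-k-1}`. -/
def topRowEquiv (B : Finset ℕ) (k : ℕ) : Equiv.Perm (Fin (B.card - k)) :=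
  Equiv.ofBijective _ (Finite.injective_iff_bijective.1 (topRow_injective B k))

/-- The sign `c_k` of the permutation of `{0, ..., g-k-1}` which sends the entries of
`(b*_1, ..., b*_{m_k}, b_{g-k-m_k}, ..., b_1)`, in this order, to `g-k-1, ..., 1, 0`. -/
def cSign (B : Finset ℕ) (k : ℕ) : ℤˣ :=
  Equiv.Perm.sign ((topRowEquiv B k).symm.trans Fin.revPerm)

/-! ### Schur functions

The variable `t_n`, `n ≥ 1`, is `MvPolynomial.X n` with `n : ℕ+`. -/

/-- The series `∑_{n ≥ 1} t_n z^n` in `z`. -/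
def tSeries : PowerSeries (MvPolynomial ℕ+ ℂ) :=
  PowerSeries.mk fun n => if h : 0 < n then MvPolynomial.X ⟨n, h⟩ else 0

/-- `p_n(t)`, the coefficient of `z^n` in `exp (∑_{n ≥ 1} t_n z^n)`, and `0` for `n < 0`. -/
def pPoly (n : ℤ) : MvPolynomial ℕ+ ℂ :=
  if 0 ≤ n then
    PowerSeries.coeff n.toNat ((PowerSeries.exp (MvPolynomial ℕ+ ℂ)).subst tSeries)
  else 0

/-- The determinant `det (p_{f_i - i + j})_{1 ≤ i, j ≤ l}` for the sequence
`(f_1, ..., f_l) = (f 0, ..., f (l-1))`; it is `1` for `l = 0`. -/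
def schurSeq (l : ℕ) (f : ℕ → ℕ) : MvPolynomial ℕ+ ℂ :=
  Matrix.det (Matrix.of fun i j : Fin l => pPoly ((f i : ℤ) - (i : ℤ) + (j : ℤ)))

/-- The Schur function `s_μ(t)`; `μ.rowLen i` is `μ_{i+1}` and `μ.colLen 0` is the length. -/
def schur (μ : YoungDiagram) : MvPolynomial ℕ+ ℂ := schurSeq (μ.colLen 0) μ.rowLen

/-! ### The series `τ` and `τ^{(k)}` -/

/-- The formal power series `∑_{μ : P μ} ξ_μ s_μ`, summed coefficientwise.  It is used only where
each coefficient involves finitely many `μ` (`schur_coeff_finite`, `schurSeq_coeff_finite`). -/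
def formalSum (P : YoungDiagram → Prop) (ξ : YoungDiagram → ℂ)
    (s : YoungDiagram → MvPolynomial ℕ+ ℂ) : MvPowerSeries ℕ+ ℂ :=
  fun d => ∑ᶠ (μ : YoungDiagram) (_ : P μ), ξ μ * MvPolynomial.coeff d (s μ)

/-- The formal power series `τ = s_λ + ∑_{μ > λ} ξ_μ s_μ`, where `λ < μ` is strict inclusion of
diagrams. -/
def tau (B : Finset ℕ) (ξ : YoungDiagram → ℂ) : MvPowerSeries ℕ+ ℂ :=
  (schur (lam B) : MvPowerSeries ℕ+ ℂ) + formalSum (fun μ => lam B < μ) ξ schur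

/-- The partition `μ` has at most `g` parts and `μ_i = λ_i` for `k+1 ≤ i ≤ g`. -/
def SameTail (B : Finset ℕ) (k : ℕ) (μ : YoungDiagram) : Prop :=
  μ.colLen 0 ≤ B.card ∧ ∀ i, k ≤ i → i < B.card → μ.rowLen i = (lam B).rowLen i

/-- The formal power series `τ^{(k)} = s_{(λ_1, ..., λ_k)} + ∑_μ ξ_μ s_{(μ_1, ..., μ_k)}`, the sum
being over the `μ > λ` with `SameTail B k μ`.  For `k = 0` the sum is empty and the series
is `1`. -/
def tauTrunc (B : Finset ℕ) (ξ : YoungDiagram → ℂ) (k : ℕ) : MvPowerSeries ℕ+ ℂ :=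
  (schurSeq k (lam B).rowLen : MvPowerSeries ℕ+ ℂ) +
    formalSum (fun μ => lam B < μ ∧ SameTail B k μ) ξ fun μ => schurSeq k μ.rowLen

/-- `∂_{t,I} = ∂_{t_{i_1}} ⋯ ∂_{t_{i_r}}` for `I = (i_1, ..., i_r)`. -/
def dList (I : List ℕ+) (f : MvPowerSeries ℕ+ ℂ) : MvPowerSeries ℕ+ ℂ :=
  I.foldr (fun i h => MvPowerSeries.pderiv ℂ i h) f

/-! ### Evaluation at `[x_1] + ... + [x_k]` -/

/-- The point `∑_{i=1}^k [x_i]`: its `n`-th coordinate is `∑_{i=1}^k x_i^n / n`, a polynomial in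
formal variables, `MvPowerSeries.X i` being `x_{i+1}`. -/
def xPoint (k : ℕ) (n : ℕ+) : MvPowerSeries ℕ ℂ :=
  ∑ i ∈ Finset.range k, ((n : ℂ)⁻¹) • (MvPowerSeries.X i) ^ (n : ℕ)

/-- The value `f (∑_{i=1}^k [x_i])`, a formal power series in the `x_i`. -/
def evalX (k : ℕ) (f : MvPowerSeries ℕ+ ℂ) : MvPowerSeries ℕ ℂ :=
  MvPowerSeries.subst (xPoint k) f

/-- `F = G + O(x_k^N)` (for `k ≥ 1`) for formal power series: `F - G` is divisible by `x_k^N`. -/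
def EqModX (k N : ℕ) (F G : MvPowerSeries ℕ ℂ) : Prop :=
  (MvPowerSeries.X (k - 1) : MvPowerSeries ℕ ℂ) ^ N ∣ F - G

/-! ### The formal sums and substitutions above are meaningful -/

theorem hasSubst_tSeries : PowerSeries.HasSubst tSeries :=
  PowerSeries.HasSubst.of_constantCoeff_zero' (by simp [tSeries])

theorem hasSubst_xPoint (k : ℕ) : MvPowerSeries.HasSubst (xPoint k) where
  const_coeff n := by simp [xPoint]
  coeff_zero d := by
    classical
    have hinj : Function.Injective ((fun n : ℕ+ => (n : ℕ))) := PNat.coe_injective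
    refine Set.Finite.subset (Set.Finite.preimage hinj.injOn (Set.finite_singleton d.degree)) ?_
    intro n hn
    simp only [Set.mem_preimage, Set.mem_singleton_iff]
    by_contra hne
    apply hn
    simp only [xPoint, map_sum, MvPowerSeries.coeff_smul]
    refine Finset.sum_eq_zero fun i _ => ?_
    rw [MvPowerSeries.coeff_X_pow, if_neg]
    · simp
    · rintro rfl
      exact hne (by simp)

theorem coeff_tSeries_pow_isWeightedHomogeneous (j n : ℕ) :
    MvPolynomial.IsWeightedHomogeneous (fun i : ℕ+ => (i : ℕ))
      (PowerSeries.coeff n (tSeries ^ j)) n := by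
  induction j generalizing n with
  | zero =>
    rw [pow_zero, PowerSeries.coeff_one]
    split_ifs with h
    · subst h; exact MvPolynomial.isWeightedHomogeneous_one _ _
    · exact MvPolynomial.isWeightedHomogeneous_zero _ _ _
  | succ j ih =>
    rw [pow_succ, PowerSeries.coeff_mul]
    refine MvPolynomial.IsWeightedHomogeneous.sum _ _ _ fun x hx => ?_
    rw [← Finset.HasAntidiagonal.mem_antidiagonal.1 hx]
    refine (ih x.1).mul ?_
    simp only [tSeries, PowerSeries.coeff_mk]
    split_ifs with h
    · exact MvPolynomial.isWeightedHomogeneous_X ℂ (fun i : ℕ+ => (i : ℕ)) ⟨x.2, h⟩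
    · exact MvPolynomial.isWeightedHomogeneous_zero _ _ _

theorem pPoly_isWeightedHomogeneous (n : ℕ) :
    MvPolynomial.IsWeightedHomogeneous (fun i : ℕ+ => (i : ℕ)) (pPoly n) n := by
  simp only [pPoly, Int.natCast_nonneg, if_true, Int.toNat_natCast]
  rw [PowerSeries.coeff_subst' hasSubst_tSeries,
    finsum_eq_sum _ (PowerSeries.coeff_subst_finite' hasSubst_tSeries _ _)]
  refine MvPolynomial.IsWeightedHomogeneous.sum _ _ _ fun j _ => ?_
  rw [PowerSeries.coeff_exp, smul_eq_mul, IsScalarTower.algebraMap_apply ℚ ℂ (MvPolynomial ℕ+ ℂ)]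
  exact (coeff_tSeries_pow_isWeightedHomogeneous j n).C_mul _

/-- The determinant is weight-homogeneous of weight `f_1 + ... + f_l`. -/
theorem schurSeq_isWeightedHomogeneous (l : ℕ) (f : ℕ → ℕ) :
    MvPolynomial.IsWeightedHomogeneous (fun i : ℕ+ => (i : ℕ)) (schurSeq l f)
      (∑ i : Fin l, f i) := by
  unfold schurSeq
  rw [Matrix.det_apply]
  refine MvPolynomial.IsWeightedHomogeneous.sum _ _ _ fun σ _ => ?_
  have key : MvPolynomial.IsWeightedHomogeneous (fun i : ℕ+ => (i : ℕ))
      (∏ i : Fin l, pPoly ((f (σ i) : ℤ) - ((σ i : ℕ) : ℤ) + ((i : ℕ) : ℤ)))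
      (∑ i : Fin l, f i) := by
    by_cases h : ∀ i : Fin l, 0 ≤ (f (σ i) : ℤ) - ((σ i : ℕ) : ℤ) + ((i : ℕ) : ℤ)
    · choose e he using fun i => Int.eq_ofNat_of_zero_le (h i)
      have hs : ∑ i : Fin l, f i = ∑ i, e i := by
        zify
        simp only [← he, Finset.sum_add_distrib, Finset.sum_sub_distrib]
        rw [Equiv.sum_comp σ (fun i : Fin l => (f i : ℤ)),
          Equiv.sum_comp σ (fun i : Fin l => ((i : ℕ) : ℤ))]
        ring
      rw [hs]
      refine MvPolynomial.IsWeightedHomogeneous.prod _ _ _ fun i _ => ?_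
      rw [he]
      exact pPoly_isWeightedHomogeneous _
    · push Not at h
      obtain ⟨i, hi⟩ := h
      rw [Finset.prod_eq_zero (Finset.mem_univ i)]
      · exact MvPolynomial.isWeightedHomogeneous_zero _ _ _
      · rw [pPoly, if_neg (not_le.2 hi)]
  have hm := (MvPolynomial.mem_weightedHomogeneousSubmodule ℂ _ _ _).2 key
  rw [← MvPolynomial.mem_weightedHomogeneousSubmodule] at *
  rcases Int.units_eq_one_or (Equiv.Perm.sign σ) with h | h
  · rw [h, one_smul]; exact hm
  · rw [h, Units.neg_smul, one_smul]; exact Submodule.neg_mem _ hm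

theorem finite_of_cells_subset (S : Finset (ℕ × ℕ)) :
    {μ : YoungDiagram | μ.cells ⊆ S}.Finite := by
  have hinj : Function.Injective YoungDiagram.cells := fun μ ν h => YoungDiagram.ext h
  refine Set.Finite.subset
    (Set.Finite.preimage hinj.injOn (S.powerset.finite_toSet)) fun μ hμ => ?_
  simpa using hμ

/-- Only finitely many Schur functions contain a given monomial. -/
theorem schur_coeff_finite (d : ℕ+ →₀ ℕ) :
    {μ : YoungDiagram | MvPolynomial.coeff d (schur μ) ≠ 0}.Finite := by
  set N := Finsupp.weight (fun i : ℕ+ => (i : ℕ)) d with hN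
  refine (finite_of_cells_subset (Finset.range N ×ˢ Finset.range N)).subset fun μ hμ => ?_
  have hw : N = ∑ i : Fin (μ.colLen 0), μ.rowLen i :=
    schurSeq_isWeightedHomogeneous _ _ hμ
  have hlen : μ.colLen 0 ≤ N := by
    rw [hw]
    calc μ.colLen 0 = ∑ _i : Fin (μ.colLen 0), 1 := by simp
      _ ≤ _ := Finset.sum_le_sum fun i _ => by
        have : ((i : ℕ), 0) ∈ μ := YoungDiagram.mem_iff_lt_colLen.2 i.2
        have := YoungDiagram.mem_iff_lt_rowLen.1 this
        omega
  rintro ⟨i, j⟩ hij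
  rw [YoungDiagram.mem_cells] at hij
  have hi : i < μ.colLen 0 :=
    YoungDiagram.mem_iff_lt_colLen.1 (μ.up_left_mem le_rfl (Nat.zero_le j) hij)
  have hj := YoungDiagram.mem_iff_lt_rowLen.1 hij
  have hrow : μ.rowLen i ≤ N := by
    rw [hw]
    exact Finset.single_le_sum (f := fun i : Fin (μ.colLen 0) => μ.rowLen i)
      (fun _ _ => Nat.zero_le _) (Finset.mem_univ ⟨i, hi⟩)
  simp only [Finset.mem_product, Finset.mem_range]
  omega

/-- Only finitely many of the `s_{(μ_1, ..., μ_k)}` in `τ^{(k)}` contain a given monomial. -/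
theorem schurSeq_coeff_finite (B : Finset ℕ) (k : ℕ) (d : ℕ+ →₀ ℕ) :
    {μ : YoungDiagram | SameTail B k μ ∧
      MvPolynomial.coeff d (schurSeq k μ.rowLen) ≠ 0}.Finite := by
  set N := Finsupp.weight (fun i : ℕ+ => (i : ℕ)) d with hN
  refine (finite_of_cells_subset
    (Finset.range k ×ˢ Finset.range N ∪ (lam B).cells)).subset fun μ hμ => ?_
  obtain ⟨⟨h1, h2⟩, h3⟩ := hμ
  have hw : N = ∑ i : Fin k, μ.rowLen i := schurSeq_isWeightedHomogeneous _ _ h3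
  rintro ⟨i, j⟩ hij
  rw [YoungDiagram.mem_cells] at hij
  have hi : i < μ.colLen 0 :=
    YoungDiagram.mem_iff_lt_colLen.1 (μ.up_left_mem le_rfl (Nat.zero_le j) hij)
  have hj := YoungDiagram.mem_iff_lt_rowLen.1 hij
  simp only [Finset.mem_union, Finset.mem_product, Finset.mem_range]
  by_cases hik : i < k
  · left
    have hrow : μ.rowLen i ≤ N := by
      rw [hw]
      exact Finset.single_le_sum (f := fun i : Fin k => μ.rowLen i)
        (fun _ _ => Nat.zero_le _) (Finset.mem_univ ⟨i, hik⟩)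
    omega
  · right
    rw [YoungDiagram.mem_cells, YoungDiagram.mem_iff_lt_rowLen, ← h2 i (by omega) (by omega)]
    exact hj

end

end GapTau

namespace GapTau

noncomputable section

/-! Since `∂_{t_i} p_n = p_{n-i}`, differentiating a Schur determinant lowers the index of one row
by `i`. So `∂_I s_μ` is a sum, over all assignments `φ` of the derivatives to the rows, of
determinants with shifted rows (`dList_pDet`). At `[x_1] + ... + [x_k]` each `p_n` becomes `h_n(x_1,
..., x_k)`, and `∑ h_n z^n` has inverse `∏ (1 - x_i z)`, of degree `k` in `z`. Column operations
with its coefficients turn every column `j ≥ k` into Kronecker deltas (`hDet_eq_of_self`), so a term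
survives only if its shifted rows `μ_r - r` (with `r` counted from `0`) take the values `-k, ...,
-(N-1)`.

The weight of `A_k` is `λ_{k+1} + ... + λ_g`. For `μ ≥ λ` this is just enough to reach those values:
the rows doing so must be the last ones, `μ` must agree with `λ` there, and no derivative can hit
the first `k` rows (`tail_of_hDet_ne_zero`). Up to the shift `g - 1` the tail rows are the gaps
`b_{g-k}, ..., b_1`, to be moved to a permutation of `0, ..., g-k-1`. The `m_k` gaps that are at
least `g - k` must each be hit, hence exactly once, and land on the non-gaps below `g - k`; this
leaves a single assignment (`eq_tailRows`). Its determinant is block triangular, a permutation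
matrix of sign `c_k` times `s_{(μ_1, ..., μ_k)}`, which is (A)(i).

For (A)(ii) a column operation with `k - 1` variables makes the last column consist of powers of
`x_k`, and expansion along it gives the leading term (`X_pow_dvd_evalX_schurSeq_sub`). (A)(iii)
combines the two, and (B) is the row analysis at `k = 0`. Infinite sums are handled one coefficient
at a time through `ColumnFinite`. -/

open PowerSeries in
/-- A solution of `dF/dz = F P` with vanishing constant term is zero. -/
theorem eq_zero_of_derivative_eq_mul {R : Type*} [CommRing R] [Algebra ℚ R]
    {F P : PowerSeries R} (hF : d⁄dX R F = F * P) (h0 : constantCoeff F = 0) : F = 0 := by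
  ext n
  induction n using Nat.strong_induction_on with
  | _ n ih =>
    rcases n with _ | n
    · simpa using h0
    · have h := congrArg (coeff n) hF
      rw [coeff_derivative, coeff_mul, Finset.sum_eq_zero] at h
      -- The coefficient of `z^n` reads `(n + 1) F_{n+1} = 0`, so inverting `n + 1` is where the
      -- `ℚ`-algebra structure enters.
      · have hu : IsUnit ((n : R) + 1) := by
          have := (IsUnit.mk0 ((n : ℚ) + 1) (Nat.cast_add_one_ne_zero n)).map (algebraMap ℚ R)
          simpa using this
        simpa using (hu.mul_left_eq_zero).1 h
      · intro x hx
        have := Finset.HasAntidiagonal.mem_antidiagonal.1 hx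
        rw [ih x.1 (by omega)]
        simp

/-! ### The polynomials `p_n` and their derivatives -/

/-- The generating series `∑ p_n z^n = exp (∑ t_n z^n)`. -/
def pSeries : PowerSeries (MvPolynomial ℕ+ ℂ) :=
  (PowerSeries.exp (MvPolynomial ℕ+ ℂ)).subst tSeries

theorem coeff_pSeries (n : ℕ) : PowerSeries.coeff n pSeries = pPoly n := by
  simp [pPoly, pSeries]

theorem pPoly_of_neg {n : ℤ} (hn : n < 0) : pPoly n = 0 := by
  rw [pPoly, if_neg (not_le.2 hn)]

theorem constantCoeff_pSeries : PowerSeries.constantCoeff pSeries = 1 := by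
  rw [pSeries, ← PowerSeries.coeff_zero_eq_constantCoeff_apply,
    PowerSeries.coeff_subst' hasSubst_tSeries, finsum_eq_single _ 0]
  · simp
  · intro n hn
    simp [tSeries, hn]

theorem pPoly_zero : pPoly 0 = 1 := by
  rw [← constantCoeff_pSeries, ← PowerSeries.coeff_zero_eq_constantCoeff_apply, coeff_pSeries]
  rfl

open PowerSeries in
theorem derivative_pSeries :
    d⁄dX _ pSeries = pSeries * d⁄dX _ tSeries := by
  rw [pSeries, derivative_subst hasSubst_tSeries, derivative_exp]

open PowerSeries in
theorem coeff_derivative_tSeries (n : ℕ) :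
    coeff n (d⁄dX _ tSeries) = (n + 1 : MvPolynomial ℕ+ ℂ) * MvPolynomial.X n.succPNat := by
  rw [coeff_derivative, tSeries, coeff_mk, dif_pos (Nat.succ_pos n), mul_comm]
  rfl

-- Formally this is `∂_{t_i} exp T = z^i exp T` with `T = ∑ t_n z^n`. Both sides satisfy the same
-- inhomogeneous equation `dF/dz = F T' + i z^{i-1} exp T`, so their difference falls under
-- `eq_zero_of_derivative_eq_mul`.
open PowerSeries in
theorem mk_pderiv_pSeries (i : ℕ+) :
    PowerSeries.mk (fun n => MvPolynomial.pderiv i (coeff n pSeries)) =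
      X ^ (i : ℕ) * pSeries := by
  rw [← sub_eq_zero]
  obtain ⟨i, rfl⟩ : ∃ j : ℕ, i = j.succPNat := ⟨i.natPred, by simp⟩
  refine eq_zero_of_derivative_eq_mul (P := d⁄dX _ tSeries) ?_ ?_
  · have h1 : d⁄dX _ (PowerSeries.mk fun n =>
        MvPolynomial.pderiv i.succPNat (coeff n pSeries)) =
        (PowerSeries.mk fun n => MvPolynomial.pderiv i.succPNat (coeff n pSeries)) *
          d⁄dX _ tSeries + pSeries * ((i + 1 : MvPolynomial ℕ+ ℂ) • X ^ i) := by
      ext1 n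
      -- The inhomogeneous term comes from `∂_{t_{i+1}}` acting on the coefficient `(n + 1) t_{n+1}`
      -- of `T'`.
      have h := congrArg (fun F => MvPolynomial.pderiv i.succPNat (coeff n F)) derivative_pSeries
      rw [coeff_derivative, coeff_mul, map_sum, Derivation.leibniz] at h
      simp only [Derivation.leibniz, smul_eq_mul] at h
      rw [coeff_derivative, coeff_mk, map_add, coeff_mul, coeff_mul, ← Finset.sum_add_distrib]
      have h2 : MvPolynomial.pderiv i.succPNat ((n : MvPolynomial ℕ+ ℂ) + 1) = 0 := by
        simp
      rw [h2, mul_zero, zero_add, mul_comm] at h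
      rw [h]
      refine Finset.sum_congr rfl fun x _ => ?_
      rw [coeff_mk, coeff_derivative_tSeries,
        coeff_smul, coeff_X_pow, smul_eq_mul, Derivation.leibniz, MvPolynomial.pderiv_X]
      have h3 : MvPolynomial.pderiv i.succPNat ((x.2 : MvPolynomial ℕ+ ℂ) + 1) = 0 := by
        simp
      rw [h3, smul_zero, add_zero, Pi.single_apply, smul_eq_mul]
      have h4 : (x.2.succPNat = i.succPNat) ↔ x.2 = i := by simp
      simp only [h4]
      split_ifs with h
      · rw [h]; ring
      · ring
    rw [map_sub, h1, Derivation.leibniz, derivative_pSeries, derivative_pow, sub_mul,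
      smul_eq_mul, smul_eq_mul, derivative_X, PowerSeries.smul_eq_C_mul]
    simp
    ring
  · rw [map_sub, ← PowerSeries.coeff_zero_eq_constantCoeff_apply, coeff_mk, coeff_pSeries,
      Nat.cast_zero, pPoly_zero]
    simp

/-- The source of all row shifts. The convention `p_n = 0` for `n < 0` makes it valid for every
integer `n`. -/
theorem pderiv_pPoly (i : ℕ+) (n : ℤ) :
    MvPolynomial.pderiv i (pPoly n) = pPoly (n - (i : ℕ)) := by
  rcases lt_or_ge n 0 with hn | hn
  · rw [pPoly_of_neg hn, pPoly_of_neg (by omega), map_zero]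
  · lift n to ℕ using hn
    have h := congrArg (PowerSeries.coeff n) (mk_pderiv_pSeries i)
    rw [PowerSeries.coeff_mk, PowerSeries.coeff_X_pow_mul', coeff_pSeries] at h
    rw [h]
    split_ifs with h1
    · rw [coeff_pSeries, Nat.cast_sub h1]
    · rw [pPoly_of_neg (by omega)]

/-! ### Complete symmetric functions -/

/-- `p_n ([x_1] + ... + [x_k])`, the complete symmetric function `h_n (x_1, ..., x_k)`. -/
def hSym (k : ℕ) (n : ℤ) : MvPowerSeries ℕ ℂ := MvPolynomial.aeval (xPoint k) (pPoly n)

/-- The generating series of the complete symmetric functions. -/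
def hSeries (k : ℕ) : PowerSeries (MvPowerSeries ℕ ℂ) :=
  PowerSeries.map (MvPolynomial.aeval (R := ℂ) (xPoint k)).toRingHom pSeries

theorem coeff_hSeries (k n : ℕ) : PowerSeries.coeff n (hSeries k) = hSym k n := by
  rw [hSeries, PowerSeries.coeff_map, coeff_pSeries]; rfl

theorem hSym_of_neg {k : ℕ} {n : ℤ} (hn : n < 0) : hSym k n = 0 := by
  rw [hSym, pPoly_of_neg hn, map_zero]

theorem hSym_zero (k : ℕ) : hSym k 0 = 1 := by
  rw [hSym, pPoly_zero, map_one]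

theorem constantCoeff_hSeries (k : ℕ) : PowerSeries.constantCoeff (hSeries k) = 1 := by
  rw [← PowerSeries.coeff_zero_eq_constantCoeff_apply, coeff_hSeries, Nat.cast_zero, hSym_zero]

-- The factor `n` produced by `d/dz` cancels the denominator of `x_i^n / n`, leaving power sums.
open PowerSeries in
theorem derivative_hSeries (k : ℕ) :
    d⁄dX _ (hSeries k) = hSeries k *
      ∑ i ∈ Finset.range k,
        PowerSeries.mk fun n => (MvPowerSeries.X i : MvPowerSeries ℕ ℂ) ^ (n + 1) := by
  have h := congrArg (PowerSeries.map (MvPolynomial.aeval (R := ℂ) (xPoint k)).toRingHom)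
    derivative_pSeries
  rw [map_mul] at h
  convert h using 1
  · ext1 n
    rw [coeff_derivative, coeff_map, coeff_derivative, hSeries, coeff_map]
    simp
  · rw [hSeries]
    congr 1
    ext1 n
    rw [coeff_map, coeff_derivative_tSeries]
    simp only [map_sum, coeff_mk]
    simp [xPoint, Finset.mul_sum]
    refine Finset.sum_congr rfl fun i _ => ?_
    have : ((n : MvPowerSeries ℕ ℂ) + 1) = algebraMap ℂ (MvPowerSeries ℕ ℂ) ((n : ℂ) + 1) := by simp
    rw [this, ← Algebra.smul_def, smul_smul, inv_mul_cancel₀ (Nat.cast_add_one_ne_zero n), one_smul]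

-- Multiplying by `1 - x_{k+1} z` removes the geometric series of `x_{k+1}` from the logarithmic
-- derivative. Both sides then solve the same equation with the same constant term.
open PowerSeries in
theorem hSeries_succ_mul (k : ℕ) :
    hSeries (k + 1) * (1 - C (MvPowerSeries.X k) * X) = hSeries k := by
  rw [← sub_eq_zero]
  refine eq_zero_of_derivative_eq_mul (P := ∑ i ∈ Finset.range k,
    PowerSeries.mk fun n => (MvPowerSeries.X i : MvPowerSeries ℕ ℂ) ^ (n + 1)) ?_ ?_
  · have hgeom : (PowerSeries.mk fun n => (MvPowerSeries.X k : MvPowerSeries ℕ ℂ) ^ (n + 1)) *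
        (1 - C (MvPowerSeries.X k) * X) = C (MvPowerSeries.X k) := by
      ext1 n
      rw [mul_sub, mul_one, map_sub, ← mul_assoc, coeff_mk]
      rcases n with _ | n
      · simp
      · rw [coeff_succ_mul_X, coeff_mul_C, coeff_mk, coeff_C, if_neg (by omega)]
        ring
    rw [map_sub, Derivation.leibniz, derivative_hSeries, derivative_hSeries,
      Finset.sum_range_succ, map_sub, Derivation.leibniz, derivative_X]
    simp only [smul_eq_mul, derivative_C, mul_zero, add_zero, mul_one]
    rw [show d⁄dX (MvPowerSeries ℕ ℂ) 1 = 0 from Derivation.map_one_eq_zero _]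
    linear_combination hSeries (k + 1) * hgeom
  · simp [constantCoeff_hSeries]

/-- The polynomial `∏ (1 - x_i z)`, as a power series in `z`. -/
def eSeries (k : ℕ) : PowerSeries (MvPowerSeries ℕ ℂ) :=
  ∏ i ∈ Finset.range k, (1 - PowerSeries.C (MvPowerSeries.X i) * PowerSeries.X)

theorem hSeries_zero : hSeries 0 = 1 := by
  rw [← sub_eq_zero]
  refine eq_zero_of_derivative_eq_mul (P := 0) ?_ ?_
  · rw [map_sub, derivative_hSeries]
    simp
  · simp [constantCoeff_hSeries]

theorem hSeries_mul_eSeries (k : ℕ) : hSeries k * eSeries k = 1 := by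
  induction k with
  | zero => simp [hSeries_zero, eSeries]
  | succ k ih =>
    rw [eSeries, Finset.prod_range_succ, mul_comm (∏ i ∈ _, _), ← mul_assoc, hSeries_succ_mul]
    exact ih

open PowerSeries in
theorem coeff_eSeries_of_lt {k n : ℕ} (h : k < n) : coeff n (eSeries k) = 0 := by
  induction k generalizing n with
  | zero => rw [eSeries, Finset.prod_range_zero, coeff_one, if_neg (by omega)]
  | succ k ih =>
    rw [eSeries, Finset.prod_range_succ, mul_sub, mul_one, ← mul_assoc, map_sub]
    rcases n with _ | n
    · omega
    · rw [coeff_succ_mul_X, coeff_mul_C]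
      have h1 := ih (n := n + 1) (by omega)
      have h2 := ih (n := n) (by omega)
      rw [eSeries] at h1 h2
      rw [h1, h2]
      simp

theorem constantCoeff_eSeries (k : ℕ) : PowerSeries.constantCoeff (eSeries k) = 1 := by
  simp [eSeries, map_prod]

theorem hSym_succ_sub (k : ℕ) (n : ℤ) :
    hSym (k + 1) n - hSym (k + 1) (n - 1) * MvPowerSeries.X k = hSym k n := by
  rcases lt_or_ge n 0 with hn | hn
  · rw [hSym_of_neg hn, hSym_of_neg hn, hSym_of_neg (by omega)]
    simp
  · lift n to ℕ using hn
    have h := congrArg (PowerSeries.coeff n) (hSeries_succ_mul k)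
    rw [mul_sub, mul_one, map_sub, ← mul_assoc, coeff_hSeries, coeff_hSeries] at h
    rw [← h]
    rcases n with _ | n
    · simp [hSym_of_neg]
    · rw [PowerSeries.coeff_succ_mul_X, PowerSeries.coeff_mul_C, coeff_hSeries]
      simp

/-- The geometric series `1 / (1 - x_{k+1} z)` as a quotient of generating series. -/
theorem coeff_hSeries_succ_mul_eSeries (k n : ℕ) :
    PowerSeries.coeff n (hSeries (k + 1) * eSeries k) = MvPowerSeries.X k ^ n := by
  have h := hSeries_mul_eSeries (k + 1)
  rw [eSeries, Finset.prod_range_succ, ← mul_assoc, ← eSeries] at h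
  induction n with
  | zero =>
    rw [PowerSeries.coeff_zero_eq_constantCoeff_apply, map_mul, constantCoeff_eSeries,
      constantCoeff_hSeries, one_mul, pow_zero]
  | succ n ih =>
    have h1 := congrArg (PowerSeries.coeff (n + 1)) h
    rw [mul_sub, mul_one, map_sub, ← mul_assoc (hSeries (k + 1) * eSeries k),
      PowerSeries.coeff_succ_mul_X, PowerSeries.coeff_mul_C, ih, PowerSeries.coeff_one,
      if_neg (by omega), sub_eq_zero] at h1
    rw [h1, pow_succ]

/-! ### Determinants with shifted rows -/

/-- A derivation applied to a determinant differentiates one row at a time. -/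
theorem derivation_det {n : Type*} [Fintype n] [DecidableEq n] {R A : Type*} [CommRing R]
    [CommRing A] [Algebra R A] (D : Derivation R A A) (M : Matrix n n A) :
    D M.det = ∑ r, (M.updateRow r fun j => D (M r j)).det := by
  classical
  have hprod : ∀ (s : Finset n) (f : n → A),
      D (∏ i ∈ s, f i) = ∑ r ∈ s, ∏ i ∈ s, Function.update f r (D (f r)) i := by
    intro s f
    induction s using Finset.induction_on with
    | empty => simp
    | insert a s ha ih =>
      rw [Finset.prod_insert ha, D.leibniz, ih, Finset.sum_insert ha, Finset.prod_insert ha,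
        Function.update_self, smul_eq_mul, smul_eq_mul, Finset.mul_sum, add_comm, mul_comm]
      congr 1
      · congr 1
        refine Finset.prod_congr rfl fun i hi => ?_
        rw [Function.update_of_ne (by rintro rfl; exact ha hi)]
      · refine Finset.sum_congr rfl fun r hr => ?_
        rw [Finset.prod_insert ha, Function.update_of_ne (by rintro rfl; exact ha hr)]
  simp only [Matrix.det_apply]
  rw [map_sum, Finset.sum_comm]
  refine Finset.sum_congr rfl fun σ _ => ?_
  rw [← Finset.smul_sum, Units.smul_def, Units.smul_def, map_zsmul, hprod,
    -- `Matrix.det_apply` uses the entries `M (σ i) i`, so the differentiated row is indexed as `σ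
    -- r`.
    ← Equiv.sum_comp σ fun r => ∏ i, M.updateRow r (fun j => D (M r j)) (σ i) i]
  congr 1
  refine Finset.sum_congr rfl fun r _ => Finset.prod_congr rfl fun i _ => ?_
  rcases eq_or_ne i r with rfl | h
  · simp
  · rw [Function.update_of_ne h, Matrix.updateRow_ne (by simpa using h)]

/-- `det (p_{b_i + j})` for `0 ≤ j < N`. -/
def pDet {N : ℕ} (b : Fin N → ℤ) : MvPolynomial ℕ+ ℂ :=
  Matrix.det (Matrix.of fun i j : Fin N => pPoly (b i + (j : ℕ)))

theorem schurSeq_eq_pDet (l : ℕ) (f : ℕ → ℕ) :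
    schurSeq l f = pDet fun i : Fin l => (f i : ℤ) - (i : ℕ) := rfl

theorem pderiv_pDet {N : ℕ} (i : ℕ+) (b : Fin N → ℤ) :
    MvPolynomial.pderiv i (pDet b) = ∑ r, pDet (b - Pi.single r ((i : ℕ) : ℤ)) := by
  rw [pDet, derivation_det]
  refine Finset.sum_congr rfl fun r _ => ?_
  rw [pDet]
  congr 1
  ext1 s j
  rcases eq_or_ne s r with rfl | h
  · simp only [Matrix.updateRow_self, Matrix.of_apply, pderiv_pPoly, Pi.sub_apply,
      Pi.single_eq_same]
    congr 1; ring
  · simp [Matrix.updateRow_ne h, Pi.single_eq_of_ne h]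

/-- Total amount subtracted from each row when the `l`-th derivative hits the row `φ l`. -/
def rowDec {N m : ℕ} (I : Fin m → ℕ+) (φ : Fin m → Fin N) : Fin N → ℤ :=
  ∑ l, Pi.single (φ l) ((I l : ℕ) : ℤ)

/-- Each derivative chooses its row independently, and several may choose the same one; hence the
sum over all functions `φ`. -/
theorem dList_pDet {N m : ℕ} (I : Fin m → ℕ+) (b : Fin N → ℤ) :
    dList (List.ofFn I) (pDet b : MvPowerSeries ℕ+ ℂ) =
      ∑ φ : Fin m → Fin N, (pDet (b - rowDec I φ) : MvPowerSeries ℕ+ ℂ) := by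
  induction m with
  | zero => simp [dList, rowDec]
  | succ m ih =>
    rw [List.ofFn_succ]
    change MvPowerSeries.pderiv ℂ (I 0) (dList (List.ofFn fun i => I i.succ) _) = _
    rw [ih, map_sum, ← Equiv.sum_comp (Fin.consEquiv fun _ => Fin N), Fintype.sum_prod_type,
      Finset.sum_comm]
    refine Finset.sum_congr rfl fun φ _ => ?_
    rw [MvPowerSeries.pderiv_coe, pderiv_pDet, ← MvPolynomial.coeToMvPowerSeries.ringHom_apply,
      map_sum]
    refine Finset.sum_congr rfl fun r _ => ?_
    rw [MvPolynomial.coeToMvPowerSeries.ringHom_apply]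
    congr 2
    rw [rowDec, rowDec, Fin.sum_univ_succ]
    simp [sub_sub, add_comm]

/-! ### Determinants of complete symmetric functions -/

/-- `det (h_{b_i + j} (x_1, ..., x_k))` for `0 ≤ j < N`. -/
def hDet (k : ℕ) {N : ℕ} (b : Fin N → ℤ) : MvPowerSeries ℕ ℂ :=
  Matrix.det (Matrix.of fun i j : Fin N => hSym k (b i + (j : ℕ)))

theorem evalX_coe (k : ℕ) (p : MvPolynomial ℕ+ ℂ) :
    evalX k (p : MvPowerSeries ℕ+ ℂ) = MvPolynomial.aeval (xPoint k) p :=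
  MvPowerSeries.subst_coe p

theorem evalX_pDet (k : ℕ) {N : ℕ} (b : Fin N → ℤ) :
    evalX k (pDet b : MvPowerSeries ℕ+ ℂ) = hDet k b := by
  rw [evalX_coe, pDet, hDet, AlgHom.map_det]
  rfl

theorem evalX_dList_pDet (k : ℕ) {N m : ℕ} (I : Fin m → ℕ+) (b : Fin N → ℤ) :
    evalX k (dList (List.ofFn I) (pDet b : MvPowerSeries ℕ+ ℂ)) =
      ∑ φ : Fin m → Fin N, hDet k (b - rowDec I φ) := by
  rw [dList_pDet, evalX, ← MvPowerSeries.substAlgHom_apply (hasSubst_xPoint k), map_sum]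
  simp only [MvPowerSeries.substAlgHom_apply, ← evalX_pDet, evalX]

/-- Column operations by a polynomial `q` of degree at most `k` with constant term `1` replace `h`
by its convolution with `q` in the columns of index at least `k`. -/
theorem det_shift_eq {R : Type*} [CommRing R] {N : ℕ} (k : ℕ) (h : ℤ → R) (q : ℕ → R)
    (hq0 : q 0 = 1) (hq : ∀ l, k < l → q l = 0) (b : Fin N → ℤ) :
    Matrix.det (Matrix.of fun i j : Fin N => h (b i + (j : ℕ))) =
      Matrix.det (Matrix.of fun i j : Fin N => if (j : ℕ) < k then h (b i + (j : ℕ)) else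
        ∑ l ∈ Finset.range (k + 1), h (b i + (j : ℕ) - (l : ℕ)) * q l) := by
  -- Unitriangular: the identity in columns below `k`, the convolution with `q` in the others. Since
  -- `j ≥ k` there, all the columns `j, j - 1, ..., j - k` that `q` needs exist.
  set U : Matrix (Fin N) (Fin N) R := Matrix.of fun l j =>
    if (j : ℕ) < k then (if l = j then 1 else 0) else
      if (l : ℕ) ≤ j then q (j - l) else 0 with hU
  have hdet : U.det = 1 := by
    rw [Matrix.det_of_isUpperTriangular]
    · refine Finset.prod_eq_one fun i _ => ?_
      simp [hU, hq0]
    · intro i j hij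
      have hij' : (j : ℕ) < i := hij
      simp only [hU, Matrix.of_apply]
      rw [if_neg (show ¬ i = j by rintro rfl; omega), if_neg (show ¬ (i : ℕ) ≤ j by omega),
        ite_self]
  rw [← mul_one (Matrix.det _), ← hdet, ← Matrix.det_mul]
  congr 1
  ext1 i j
  rw [Matrix.mul_apply]
  simp only [hU, Matrix.of_apply]
  split_ifs with hj
  · simp
  · simp only [mul_ite, mul_zero]
    rw [Fin.sum_univ_eq_sum_range (fun l : ℕ =>
      if l ≤ (j : ℕ) then h (b i + l) * q (j - l) else 0), ← Finset.sum_filter]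
    have hfil : (Finset.range N).filter (fun l => l ≤ (j : ℕ)) = Finset.range (j + 1) := by
      ext l; simp; omega
    rw [hfil, ← Finset.sum_range_reflect, ← Finset.sum_subset
      (Finset.range_subset_range.2 (show k + 1 ≤ (j : ℕ) + 1 by omega))]
    · refine Finset.sum_congr rfl fun l hl => ?_
      rw [Finset.mem_range] at hl
      rw [show (j : ℕ) - (j + 1 - 1 - l) = l by omega, Nat.add_sub_cancel,
        Nat.cast_sub (by omega)]
      congr 2; ring
    · intro l hl hl'
      rw [Finset.mem_range] at hl hl'
      rw [hq _ (by omega), mul_zero]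

/-- Used for `k' = k`, where the product of series is `1`, and for `k = k' + 1`, where it is a
geometric series. -/
theorem sum_hSym_mul_coeff (k k' : ℕ) (n : ℤ) :
    ∑ l ∈ Finset.range (k' + 1), hSym k (n - (l : ℕ)) * PowerSeries.coeff l (eSeries k') =
      if 0 ≤ n then PowerSeries.coeff n.toNat (hSeries k * eSeries k') else 0 := by
  split_ifs with hn
  · lift n to ℕ using hn
    rw [Int.toNat_natCast, mul_comm, PowerSeries.coeff_mul,
      Finset.Nat.sum_antidiagonal_eq_sum_range_succ_mk]
    have key : ∀ M, n ≤ M → k' ≤ M →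
        ∑ l ∈ Finset.range (k' + 1), hSym k (n - (l : ℕ)) * PowerSeries.coeff l (eSeries k') =
        ∑ l ∈ Finset.range (M + 1), hSym k (n - (l : ℕ)) * PowerSeries.coeff l (eSeries k') ∧
        ∑ l ∈ Finset.range n.succ, PowerSeries.coeff l (eSeries k') *
          PowerSeries.coeff (n - l) (hSeries k) =
        ∑ l ∈ Finset.range (M + 1), hSym k (n - (l : ℕ)) * PowerSeries.coeff l (eSeries k') := by
      intro M h1 h2
      constructor
      · refine Finset.sum_subset (Finset.range_subset_range.2 (by omega)) fun l _ hl => ?_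
        rw [Finset.mem_range] at hl
        rw [coeff_eSeries_of_lt (by omega), mul_zero]
      · rw [← Finset.sum_subset (Finset.range_subset_range.2 (show n.succ ≤ M + 1 by omega))]
        · refine Finset.sum_congr rfl fun l hl => ?_
          rw [Finset.mem_range] at hl
          rw [coeff_hSeries, mul_comm, Nat.cast_sub (by omega)]
        · intro l _ hl
          rw [Finset.mem_range] at hl
          rw [hSym_of_neg (by omega), zero_mul]
    -- Any common upper bound of the two summation ranges would do.
    obtain ⟨h1, h2⟩ := key (n + k') (by omega) (by omega)
    rw [h1, h2]
  · refine Finset.sum_eq_zero fun l _ => ?_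
    rw [hSym_of_neg (by omega), zero_mul]

/-- The column operations use the inverse of the generating series of the `h_n`, so the modified
columns become Kronecker deltas. -/
theorem hDet_eq_of_self (k : ℕ) {N : ℕ} (b : Fin N → ℤ) :
    hDet k b = Matrix.det (Matrix.of fun i j : Fin N =>
      if (j : ℕ) < k then hSym k (b i + (j : ℕ)) else if b i + (j : ℕ) = 0 then 1 else 0) := by
  rw [hDet, det_shift_eq k (hSym k) (fun l => PowerSeries.coeff l (eSeries k))
    (by simpa using constantCoeff_eSeries k) (fun l => coeff_eSeries_of_lt)]
  congr 1
  ext1 i j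
  simp only [Matrix.of_apply, sum_hSym_mul_coeff, hSeries_mul_eSeries, PowerSeries.coeff_one]
  split_ifs <;> first | rfl | omega

/-- If the determinant is nonzero, the rows realise all the values `-k, ..., -(N-1)`. -/
theorem exists_perm_of_hDet_ne_zero {k N : ℕ} {b : Fin N → ℤ} (h : hDet k b ≠ 0) :
    ∃ σ : Equiv.Perm (Fin N), ∀ j : Fin N, k ≤ j → b (σ j) = -((j : ℕ) : ℤ) := by
  rw [hDet_eq_of_self, Matrix.det_apply] at h
  obtain ⟨σ, -, hσ⟩ := Finset.exists_ne_zero_of_sum_ne_zero h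
  refine ⟨σ, fun j hj => ?_⟩
  by_contra hne
  apply hσ
  rw [Finset.prod_eq_zero (Finset.mem_univ j), smul_zero]
  rw [Matrix.of_apply, if_neg (by omega), if_neg (by omega)]

/-- Evaluation of the determinant when the rows of index at least `k` realise the values
`-k, ..., -(N-1)` through a permutation. -/
theorem hDet_of_tail_perm {k r N : ℕ} (hN : k + r = N) (b : Fin N → ℤ)
    (π : Equiv.Perm (Fin r))
    (hb : ∀ l : Fin r, b ⟨k + l, by omega⟩ = -((k + (π l : ℕ) : ℕ) : ℤ)) :
    hDet k b = (Equiv.Perm.sign π : ℤ) •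
      hDet k (fun i : Fin k => b ⟨i, by omega⟩) := by
  subst hN
  rw [hDet_eq_of_self, ← Matrix.det_submatrix_equiv_self finSumFinEquiv]
  rw [← Matrix.fromBlocks_toBlocks (Matrix.submatrix _ _ _)]
  -- Row `k + l` has index `-(k + π l)`, so in columns below `k` all its entries are `h_n` with `n <
  -- 0`.
  have h21 : (Matrix.submatrix (Matrix.of fun i j : Fin (k + r) =>
      if (j : ℕ) < k then hSym k (b i + (j : ℕ)) else if b i + (j : ℕ) = 0 then 1 else 0)
      finSumFinEquiv finSumFinEquiv).toBlocks₂₁ = 0 := by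
    ext1 l i
    simp only [Matrix.toBlocks₂₁, Matrix.of_apply, Matrix.submatrix_apply,
      finSumFinEquiv_apply_left, finSumFinEquiv_apply_right, Fin.val_castAdd, Matrix.zero_apply]
    rw [if_pos i.2]
    have := hb l
    refine hSym_of_neg ?_
    rw [show Fin.natAdd k l = ⟨k + l, by omega⟩ from rfl, this]
    push_cast
    omega
  rw [h21, Matrix.det_fromBlocks_zero₂₁, mul_comm, zsmul_eq_mul]
  congr 1
  · rw [← Matrix.det_permutation]
    congr 1
    ext1 l j
    simp only [Matrix.toBlocks₂₂, Matrix.of_apply, Matrix.submatrix_apply,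
      finSumFinEquiv_apply_right, Fin.val_natAdd, PEquiv.toMatrix_apply, Equiv.toPEquiv_apply,
      Option.mem_def, Option.some_inj]
    rw [if_neg (by omega), show Fin.natAdd k l = ⟨k + l, by omega⟩ from rfl, hb]
    have : (-((k + (π l : ℕ) : ℕ) : ℤ) + ((k + (j : ℕ) : ℕ) : ℤ) = 0) ↔ π l = j := by
      rw [Fin.ext_iff]; omega
    simp only [this]
  · rw [hDet]
    congr 1
    ext1 i j
    simp only [Matrix.toBlocks₁₁, Matrix.of_apply, Matrix.submatrix_apply,
      finSumFinEquiv_apply_left, Fin.val_castAdd]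
    rw [if_pos j.2]
    rfl

/-! ### Combinatorics of the rows -/

/-- The last row is `(0, ..., 0, 1)`. Zero parts may therefore be appended, and diagrams of
different lengths treated with a common number of rows. -/
theorem schurSeq_succ_of_eq_zero {l : ℕ} {f : ℕ → ℕ} (h : f l = 0) :
    schurSeq (l + 1) f = schurSeq l f := by
  rw [schurSeq, Matrix.det_succ_row _ (Fin.last l), Finset.sum_eq_single (Fin.last l)]
  · rw [Matrix.of_apply, Fin.val_last, h]
    simp only [Nat.cast_zero, zero_sub, neg_add_cancel, pPoly_zero, mul_one]
    rw [← two_mul, pow_mul, neg_one_sq, one_pow, one_mul, schurSeq]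
    congr 1
    ext1 i j
    simp
  · intro j _ hj
    have hj' : (j : ℕ) < l := by
      have := j.2
      have : (j : ℕ) ≠ l := fun h => hj (Fin.ext h)
      omega
    rw [Matrix.of_apply, Fin.val_last, h, pPoly_of_neg (by push_cast; omega)]
    simp
  · simp

theorem rowLen_eq_zero {μ : YoungDiagram} {i : ℕ} (h : μ.colLen 0 ≤ i) : μ.rowLen i = 0 := by
  by_contra hne
  have : (i, 0) ∈ μ := YoungDiagram.mem_iff_lt_rowLen.2 (Nat.pos_of_ne_zero hne)
  have := YoungDiagram.mem_iff_lt_colLen.1 this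
  omega

theorem schur_eq_schurSeq {μ : YoungDiagram} {N : ℕ} (h : μ.colLen 0 ≤ N) :
    schur μ = schurSeq N μ.rowLen := by
  induction N, h using Nat.le_induction with
  | base => rfl
  | succ n hn ih => rw [schurSeq_succ_of_eq_zero (rowLen_eq_zero hn), ih]

theorem rowLen_mono {μ ν : YoungDiagram} (h : μ ≤ ν) (i : ℕ) : μ.rowLen i ≤ ν.rowLen i := by
  by_contra hlt
  have : (i, ν.rowLen i) ∈ μ := YoungDiagram.mem_iff_lt_rowLen.2 (by omega)
  have := YoungDiagram.mem_iff_lt_rowLen.1 (h this)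
  omega

theorem ext_rowLen {μ ν : YoungDiagram} (h : ∀ i, μ.rowLen i = ν.rowLen i) : μ = ν := by
  ext ⟨i, j⟩
  rw [YoungDiagram.mem_cells, YoungDiagram.mem_cells, YoungDiagram.mem_iff_lt_rowLen,
    YoungDiagram.mem_iff_lt_rowLen, h]

theorem le_gap_self {B : Finset ℕ} {i : ℕ} (hi : i < B.card) : i ≤ gap B i :=
  Nat.le_nth (gap_cond hi)

/-- Up to the common shift `g - 1`, the row indices of the determinant `s_λ` are the gaps in
decreasing order. -/
theorem lamPart_sub {B : Finset ℕ} {r : ℕ} (hr : r < B.card) :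
    (lamPart B r : ℤ) - r = gap B (B.card - 1 - r) - (B.card - 1 : ℤ) := by
  have := le_gap_self (B := B) (i := B.card - 1 - r) (by omega)
  rw [lamPart, if_pos hr, Nat.cast_sub this]
  omega

theorem lamPart_of_le {B : Finset ℕ} {r : ℕ} (hr : B.card ≤ r) : lamPart B r = 0 := by
  rw [lamPart, if_neg (by omega)]

theorem mNum_le (B : Finset ℕ) (k : ℕ) : mNum B k ≤ B.card - k := by
  have := count_add_mNum B k
  omega

/-- The weight of the a-sequence is `λ_{k+1} + ... + λ_g`. -/
theorem sum_aSeq (B : Finset ℕ) (k : ℕ) :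
    ∑ i : Fin (mNum B k), (((gap B (B.card - k - 1 - i) - nongap B i : ℕ)) : ℤ) =
      ∑ l ∈ Finset.range (B.card - k), (lamPart B (k + l) : ℤ) := by
  -- `topRow` permutes `0, ..., g-k-1`, so it may replace the staircase subtracted from the gaps.
  -- The differences `gap - topRow` are the entries of `A_k` for `l < m_k` and `0` afterwards.
  have h1 : ∑ l ∈ Finset.range (B.card - k), (topRow B k l : ℤ) =
      ∑ l ∈ Finset.range (B.card - k), (l : ℤ) := by
    rw [← Fin.sum_univ_eq_sum_range (fun l => (topRow B k l : ℤ)),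
      ← Fin.sum_univ_eq_sum_range (fun l => (l : ℤ)),
      ← Equiv.sum_comp (topRowEquiv B k) fun l : Fin (B.card - k) => ((l : ℕ) : ℤ)]
    rfl
  have h2 : ∑ l ∈ Finset.range (B.card - k), (B.card - k - 1 - l : ℤ) =
      ∑ l ∈ Finset.range (B.card - k), (l : ℤ) := by
    rw [← Finset.sum_range_reflect]
    refine Finset.sum_congr rfl fun l hl => ?_
    rw [Finset.mem_range] at hl
    omega
  have h3 : ∑ l ∈ Finset.range (B.card - k), (lamPart B (k + l) : ℤ) =
      ∑ l ∈ Finset.range (B.card - k), ((gap B (B.card - k - 1 - l) : ℤ) - topRow B k l) := by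
    rw [Finset.sum_sub_distrib, h1, ← h2, ← Finset.sum_sub_distrib]
    refine Finset.sum_congr rfl fun l hl => ?_
    rw [Finset.mem_range] at hl
    have := lamPart_sub (B := B) (r := k + l) (by omega)
    rw [show B.card - 1 - (k + l) = B.card - k - 1 - l by omega] at this
    push_cast at this
    omega
  rw [h3, Fin.sum_univ_eq_sum_range (fun i : ℕ =>
    (((gap B (B.card - k - 1 - i) - nongap B i : ℕ)) : ℤ)),
    ← Finset.sum_subset (Finset.range_subset_range.2 (mNum_le B k))]
  · refine Finset.sum_congr rfl fun l hl => ?_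
    rw [Finset.mem_range] at hl
    have := aSeq_pos hl
    rw [topRow, if_pos hl]
    omega
  · intro l _ hl
    rw [Finset.mem_range] at hl
    rw [topRow, if_neg hl, sub_self]

/-! ### Weight bounds that force the tail -/

/-- Among the sets of rows of given size, the last rows have the strictly smallest sum. -/
theorem eq_of_sum_le_sum_tail {N : ℕ} {a : Fin N → ℤ} (ha : StrictAnti a) {k : ℕ}
    {S T : Finset (Fin N)} (hT : T = Finset.univ.filter fun j : Fin N => k ≤ j)
    (hcard : S.card = T.card) (hsum : ∑ r ∈ S, a r ≤ ∑ r ∈ T, a r) : S = T := by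
  by_contra hne
  have hc : (S \ T).card = (T \ S).card := Finset.card_sdiff_comm hcard
  have hpos : 0 < (S \ T).card := by
    rw [Finset.card_pos, Finset.sdiff_nonempty]
    exact fun hsub => hne (Finset.eq_of_subset_of_card_le hsub hcard.ge)
  -- The minimum over `S \ T` separates the two differences: indices in `T \ S` are larger than
  -- those in `S \ T`, so their values are at most `a s - 1`.
  obtain ⟨s, hs, hmin⟩ := Finset.exists_min_image (S \ T) a (Finset.card_pos.1 hpos)
  have h1 : (S \ T).card • a s ≤ ∑ r ∈ S \ T, a r := Finset.card_nsmul_le_sum _ _ _ hmin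
  have h2 : ∑ r ∈ T \ S, a r ≤ (T \ S).card • (a s - 1) := by
    refine Finset.sum_le_card_nsmul _ _ _ fun t ht => ?_
    have hst : s < t := by
      simp only [hT, Finset.mem_sdiff, Finset.mem_filter, Finset.mem_univ, true_and] at hs ht
      rw [Fin.lt_def]
      omega
    have := ha hst
    omega
  have h3 := Finset.sum_sdiff_sub_sum_sdiff (s₁ := S) (s₂ := T) (f := a)
  rw [← hc, nsmul_eq_mul, mul_sub, ← nsmul_eq_mul] at h2
  have : (0 : ℤ) < ((S \ T).card : ℤ) := by exact_mod_cast hpos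
  omega

theorem rowDec_apply {N m : ℕ} (I : Fin m → ℕ+) (φ : Fin m → Fin N) (r : Fin N) :
    rowDec I φ r = ∑ l, if φ l = r then ((I l : ℕ) : ℤ) else 0 := by
  simp [rowDec, Finset.sum_apply, Pi.single_apply, eq_comm]

theorem rowDec_nonneg {N m : ℕ} (I : Fin m → ℕ+) (φ : Fin m → Fin N) (r : Fin N) :
    0 ≤ rowDec I φ r := by
  rw [rowDec_apply]
  exact Finset.sum_nonneg fun l _ => by split_ifs <;> omega

theorem sum_rowDec {N m : ℕ} (I : Fin m → ℕ+) (φ : Fin m → Fin N) :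
    ∑ r, rowDec I φ r = ∑ l, ((I l : ℕ) : ℤ) := by
  simp only [rowDec_apply]
  rw [Finset.sum_comm]
  simp

theorem exists_of_rowDec_ne_zero {N m : ℕ} {I : Fin m → ℕ+} {φ : Fin m → Fin N} {r : Fin N}
    (h : rowDec I φ r ≠ 0) : ∃ l, φ l = r := by
  rw [rowDec_apply] at h
  obtain ⟨l, -, hl⟩ := Finset.exists_ne_zero_of_sum_ne_zero h
  exact ⟨l, by by_contra hne; exact hl (if_neg hne)⟩

theorem rowDec_apply_of_injective {N m : ℕ} (I : Fin m → ℕ+) {φ : Fin m → Fin N}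
    (hφ : Function.Injective φ) (l : Fin m) : rowDec I φ (φ l) = (I l : ℕ) := by
  rw [rowDec_apply, Finset.sum_eq_single l]
  · simp
  · intro l' _ h
    rw [if_neg fun h' => h (hφ h')]
  · simp

/-- If the derivatives have total weight at most that of the tail of a sequence below `f`, then a
term can only survive if `f` has the same tail, and all the derivatives hit the tail. -/
theorem tail_of_hDet_ne_zero {k N m : ℕ} {f f' : ℕ → ℕ} (hf : Antitone f) (hle : ∀ r, f' r ≤ f r)
    (I : Fin m → ℕ+) (φ : Fin m → Fin N)
    (hw : ∑ l, ((I l : ℕ) : ℤ) ≤ ∑ r ∈ Finset.univ.filter (fun r : Fin N => k ≤ (r : ℕ)), (f' r : ℤ))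
    (h : hDet k ((fun i : Fin N => (f i : ℤ) - (i : ℕ)) - rowDec I φ) ≠ 0) :
    (∀ r : Fin N, k ≤ (r : ℕ) → f r = f' r) ∧
      (∀ r : Fin N, (r : ℕ) < k → rowDec I φ r = 0) ∧
      ∃ σ : Equiv.Perm (Fin N), (∀ j : Fin N, k ≤ (j : ℕ) ↔ k ≤ (σ j : ℕ)) ∧
        ∀ j : Fin N, k ≤ (j : ℕ) →
          (f (σ j) : ℤ) - (σ j : ℕ) - rowDec I φ (σ j) = -((j : ℕ) : ℤ) := by
  obtain ⟨σ, hσ⟩ := exists_perm_of_hDet_ne_zero h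
  set T : Finset (Fin N) := Finset.univ.filter fun j : Fin N => k ≤ (j : ℕ) with hT
  set S : Finset (Fin N) := T.map σ.toEmbedding with hS
  have ha : StrictAnti fun i : Fin N => (f i : ℤ) - (i : ℕ) := by
    intro i j hij
    have h1 : f j ≤ f i := hf hij.le
    have h2 : (i : ℕ) < j := hij
    show (f j : ℤ) - (j : ℕ) < (f i : ℤ) - (i : ℕ)
    omega
  -- With `a r = f r - r`, these estimates give `∑_S a ≤ ∑_T f' - ∑_T j ≤ ∑_T a`.
  have e1 : ∑ r ∈ S, ((f r : ℤ) - (r : ℕ)) - ∑ r ∈ S, rowDec I φ r =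
      - ∑ j ∈ T, ((j : ℕ) : ℤ) := by
    rw [← Finset.sum_sub_distrib, hS, Finset.sum_map, ← Finset.sum_neg_distrib]
    refine Finset.sum_congr rfl fun j hj => ?_
    exact hσ j (by simpa [hT] using hj)
  have e2 : ∑ r ∈ S, rowDec I φ r ≤ ∑ l, ((I l : ℕ) : ℤ) := by
    rw [← sum_rowDec I φ]
    exact Finset.sum_le_sum_of_subset_of_nonneg (Finset.subset_univ _)
      fun r _ _ => rowDec_nonneg I φ r
  have e3 : ∑ r ∈ T, (f' r : ℤ) ≤ ∑ r ∈ T, (f r : ℤ) :=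
    Finset.sum_le_sum fun r _ => by exact_mod_cast hle r
  have e4 : ∑ r ∈ T, ((f r : ℤ) - (r : ℕ)) = ∑ r ∈ T, (f r : ℤ) - ∑ j ∈ T, ((j : ℕ) : ℤ) :=
    Finset.sum_sub_distrib ..
  have hST : S = T := eq_of_sum_le_sum_tail ha hT (by simp [hS]) (by linarith)
  -- Once `S = T`, every inequality above is an equality. This gives the equality of the tails and
  -- leaves no weight for the rows outside `T`.
  rw [hST] at e1 e2
  refine ⟨fun r hr => ?_, fun r hr => ?_, σ, fun j => ?_, hσ⟩
  · have e5 : ∑ r ∈ T, (f' r : ℤ) = ∑ r ∈ T, (f r : ℤ) := by linarith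
    have := (Finset.sum_eq_sum_iff_of_le fun r _ => by exact_mod_cast hle r).1 e5 r
      (by simpa [hT] using hr)
    exact_mod_cast this.symm
  · have e6 : ∑ r ∈ Finset.univ \ T, rowDec I φ r = 0 := by
      have h1 := Finset.sum_sdiff (f := rowDec I φ) (Finset.subset_univ T)
      rw [sum_rowDec] at h1
      have h2 : 0 ≤ ∑ r ∈ Finset.univ \ T, rowDec I φ r :=
        Finset.sum_nonneg fun r _ => rowDec_nonneg I φ r
      linarith
    exact (Finset.sum_eq_zero_iff_of_nonneg fun r _ => rowDec_nonneg I φ r).1 e6 r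
      (by simpa [hT] using hr)
  · have h1 : j ∈ T ↔ σ j ∈ T := by
      conv_rhs => rw [← hST]
      simp [hS]
    simpa [hT] using h1

/-! ### The unique surviving assignment of derivatives to rows -/

/-- The a-sequence as a function. -/
def aFun (B : Finset ℕ) (k : ℕ) (i : Fin (mNum B k)) : ℕ+ :=
  ⟨gap B (B.card - k - 1 - i) - nongap B i, aSeq_pos i.2⟩

theorem aSeq_eq_ofFn (B : Finset ℕ) (k : ℕ) : aSeq B k = List.ofFn (aFun B k) := rfl

theorem aFun_add_nongap {B : Finset ℕ} {k : ℕ} (l : Fin (mNum B k)) :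
    (aFun B k l : ℕ) + nongap B l = gap B (B.card - k - 1 - l) := by
  have := aSeq_pos l.2
  simp only [aFun, PNat.mk_coe]
  omega

theorem sum_aFun {B : Finset ℕ} {k N : ℕ} (hN : B.card ≤ N) :
    ∑ l, ((aFun B k l : ℕ) : ℤ) =
      ∑ r ∈ Finset.univ.filter (fun r : Fin N => k ≤ (r : ℕ)), (lamPart B r : ℤ) := by
  have h := sum_aSeq B k
  simp only [aFun, PNat.mk_coe]
  rw [h, Finset.sum_filter, Fin.sum_univ_eq_sum_range
    (fun r => if k ≤ r then (lamPart B r : ℤ) else 0), ← Finset.sum_filter]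
  have h1 : ∑ l ∈ Finset.range (B.card - k), (lamPart B (k + l) : ℤ) =
      ∑ r ∈ Finset.Ico k B.card, (lamPart B r : ℤ) := by
    rw [Finset.sum_Ico_eq_sum_range]
  rw [h1]
  refine Finset.sum_subset (fun r hr => ?_) fun r hr hr' => ?_
  · simp only [Finset.mem_Ico, Finset.mem_filter, Finset.mem_range] at hr ⊢
    omega
  · simp only [Finset.mem_Ico, Finset.mem_filter, Finset.mem_range] at hr hr'
    rw [lamPart_of_le (by omega), Nat.cast_zero]

/-- The assignment of the derivatives to the rows `k, ..., k + m_k - 1`, in this order. -/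
def tailRows (B : Finset ℕ) (k : ℕ) (l : Fin (mNum B k)) : Fin B.card :=
  ⟨k + l, by have := mNum_le B k; omega⟩

theorem tailRows_injective (B : Finset ℕ) (k : ℕ) : Function.Injective (tailRows B k) := by
  intro i j h
  simp only [tailRows, Fin.mk.injEq] at h
  exact Fin.ext (by omega)

/-- Rows of the gaps can only be moved to a permutation of `0, ..., g-k-1` by the a-sequence if
its `l`-th entry is subtracted from the `l`-th row. -/
theorem eq_tailRows {B : Finset ℕ} {k : ℕ} (φ : Fin (mNum B k) → Fin B.card)
    (hbd : ∀ r : Fin B.card, k ≤ (r : ℕ) →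
      (gap B (B.card - 1 - r) : ℤ) - rowDec (aFun B k) φ r < ((B.card - k : ℕ) : ℤ) ∧
      0 ≤ (gap B (B.card - 1 - r) : ℤ) - rowDec (aFun B k) φ r)
    (hinj : ∀ r r' : Fin B.card, k ≤ (r : ℕ) → k ≤ (r' : ℕ) →
      (gap B (B.card - 1 - r) : ℤ) - rowDec (aFun B k) φ r =
        (gap B (B.card - 1 - r') : ℤ) - rowDec (aFun B k) φ r' → r = r') :
    φ = tailRows B k := by
  have hm := mNum_le B k
  -- The rows `k, ..., k + m_k - 1` carry gaps that are at least `g - k` and must be lowered. There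
  -- are only `m_k` derivatives, so `φ` is a bijection onto these rows, `φ l = k + s l`.
  have hhit : ∀ l : Fin (mNum B k), ∃ l', φ l' = tailRows B k l := by
    intro l
    refine exists_of_rowDec_ne_zero (I := aFun B k) fun h0 => ?_
    have h1 := (hbd (tailRows B k l) (by simp [tailRows])).1
    have h2 := le_gap (B := B) (k := k) (i := B.card - 1 - (k + l)) (by omega) (by omega)
    rw [h0] at h1
    simp only [tailRows] at h1
    omega
  choose ψ hψ using hhit
  have hψinj : Function.Injective ψ := fun i j h =>
    tailRows_injective B k (by rw [← hψ, ← hψ, h])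
  have hψsurj : Function.Surjective ψ := Finite.surjective_of_injective hψinj
  choose s hs using hψsurj
  have hφs : ∀ l, φ l = tailRows B k (s l) := fun l => by rw [← hψ, hs]
  have hsinj : Function.Injective s := fun i j h => by rw [← hs i, ← hs j, h]
  have hφinj : Function.Injective φ := fun i j h => by
    rw [hφs, hφs] at h
    exact hsinj (tailRows_injective B k h)
  have hdec0 : ∀ r : Fin B.card, k + mNum B k ≤ r → rowDec (aFun B k) φ r = 0 := by
    intro r hr
    by_contra hne
    obtain ⟨l, hl⟩ := exists_of_rowDec_ne_zero hne
    have h1 := congrArg Fin.val (hφs l)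
    rw [hl] at h1
    simp only [tailRows] at h1
    omega
  -- A lowered row cannot land on a gap: a gap below `g - k` sits in an untouched row, and two rows
  -- would then coincide.
  have hval : ∀ l, ∃ v : ℕ, v ∉ B ∧ v + aFun B k l = gap B (B.card - k - 1 - s l) := by
    intro l
    have h1 := hbd (φ l) (by rw [hφs]; simp [tailRows])
    have h2 := rowDec_apply_of_injective (aFun B k) hφinj l
    have h3 : (φ l : ℕ) = k + s l := by rw [hφs]; rfl
    rw [h2, h3, show B.card - 1 - (k + s l) = B.card - k - 1 - s l by omega] at h1
    refine ⟨gap B (B.card - k - 1 - s l) - aFun B k l, fun hmem => ?_, by omega⟩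
    set v := gap B (B.card - k - 1 - s l) - aFun B k l with hv
    set i := Nat.count (fun n => n ∈ B) v with hi
    have hgi : gap B i = v := Nat.nth_count hmem
    have hic : i < B.card := by
      have hf : (Set.ofPred (fun n => n ∈ B)).Finite := B.finite_toSet
      have h4 := Nat.count_lt_card hf hmem
      have h5 : hf.toFinset = B := by ext n; simp
      rwa [h5] at h4
    have him : i + mNum B k < B.card - k := by
      by_contra hlt
      have := le_gap (B := B) (k := k) (i := i) (by omega) hic
      omega
    have h6 := hinj (φ l) ⟨B.card - 1 - i, by omega⟩ (by omega)
      (show k ≤ B.card - 1 - i by omega) (by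
        rw [h2, h3, hdec0 _ (show k + mNum B k ≤ B.card - 1 - i by omega),
          show B.card - 1 - (k + s l) = B.card - k - 1 - s l by omega]
        simp only
        rw [show B.card - 1 - (B.card - 1 - i) = i by omega, hgi]
        omega)
    have h7 := congrArg Fin.val h6
    simp only [h3] at h7
    omega
  -- By induction the derivatives before `n` have taken the first `n` non-gaps, so the `n`-th lands
  -- on a value at least `nongap B n`. It therefore starts from a gap at least as large as that of
  -- row `k + n`, so `s n ≤ n`, and injectivity excludes `s n < n`.
  have hsid : ∀ n, ∀ hn : n < mNum B k, s ⟨n, hn⟩ = ⟨n, hn⟩ := by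
    intro n
    induction n using Nat.strong_induction_on with
    | _ n ih =>
      intro hn
      obtain ⟨v, hvB, hv⟩ := hval ⟨n, hn⟩
      set c := Nat.count (fun n => n ∉ B) v with hc
      have hvc : nongap B c = v := Nat.nth_count hvB
      have hcn : n ≤ c := by
        by_contra hlt
        have hcm : c < mNum B k := by omega
        have h1 := ih c (by omega) hcm
        have h2 := aFun_add_nongap (B := B) (k := k) ⟨c, hcm⟩
        have h3 := rowDec_apply_of_injective (aFun B k) hφinj ⟨c, hcm⟩
        have h4 := rowDec_apply_of_injective (aFun B k) hφinj ⟨n, hn⟩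
        have h5 : (φ ⟨c, hcm⟩ : ℕ) = k + c := by rw [hφs, h1]; rfl
        have h6 : (φ ⟨n, hn⟩ : ℕ) = k + s ⟨n, hn⟩ := by rw [hφs]; rfl
        have h7 := hinj (φ ⟨c, hcm⟩) (φ ⟨n, hn⟩) (by omega) (by omega) (by
          rw [h3, h4, h5, h6, show B.card - 1 - (k + c) = B.card - k - 1 - c by omega,
            show B.card - 1 - (k + s ⟨n, hn⟩) = B.card - k - 1 - s ⟨n, hn⟩ by omega]
          simp only at h2
          omega)
        have := hφinj h7
        simp only [Fin.mk.injEq] at this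
        omega
      have h1 : nongap B n ≤ nongap B c := Nat.nth_monotone (nongap_infinite B) hcn
      have h2 := aFun_add_nongap (B := B) (k := k) ⟨n, hn⟩
      have h3 : (s ⟨n, hn⟩ : ℕ) ≤ n := by
        by_contra hlt
        have := gap_lt_gap (B := B) (i := B.card - k - 1 - s ⟨n, hn⟩) (j := B.card - k - 1 - n)
          (by omega) (by omega)
        simp only at h2
        omega
      rcases h3.lt_or_eq with h4 | h4
      · have h5 := hsinj (ih _ h4 (s ⟨n, hn⟩).2)
        exact absurd (congrArg Fin.val h5) (by simp only; omega)
      · exact Fin.ext h4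
  funext l
  rw [hφs, hsid l.1 l.2]

/-! ### Derivatives of a single Schur function -/

theorem sameTail_of_forall {B : Finset ℕ} {k N : ℕ} (hk : k ≤ B.card) {μ : YoungDiagram}
    (hB : B.card ≤ N) (hμ : μ.colLen 0 ≤ N)
    (h : ∀ r : Fin N, k ≤ (r : ℕ) → μ.rowLen r = lamPart B r) : SameTail B k μ := by
  refine ⟨?_, fun i hi hi' => ?_⟩
  · by_contra hlt
    -- Row `g` (counted from `0`) belongs to the tail and `λ` is empty there, so `μ` cannot be
    -- longer than `g`.
    have h1 := h ⟨B.card, by omega⟩ hk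
    rw [lamPart_of_le le_rfl] at h1
    have h2 : (B.card, 0) ∈ μ := YoungDiagram.mem_iff_lt_colLen.2 (by omega)
    have := YoungDiagram.mem_iff_lt_rowLen.1 h2
    simp only at h1
    omega
  · rw [rowLen_lam]
    exact h ⟨i, by omega⟩ hi

theorem rowLen_antitone (μ : YoungDiagram) : Antitone μ.rowLen := fun _ _ h => μ.rowLen_anti _ _ h

theorem lamPart_le_rowLen {B : Finset ℕ} {μ : YoungDiagram} (hμ : lam B ≤ μ) (r : ℕ) :
    lamPart B r ≤ μ.rowLen r := by
  rw [← rowLen_lam]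
  exact rowLen_mono hμ r

/-- Taking the larger of `g` and the length of `μ` as number of rows also covers diagrams with more
than `g` parts. -/
theorem evalX_dList_schur_of_not_sameTail {B : Finset ℕ} {k : ℕ} (hk : k ≤ B.card)
    {μ : YoungDiagram} (hμ : lam B ≤ μ) (hns : ¬ SameTail B k μ) :
    evalX k (dList (aSeq B k) (schur μ : MvPowerSeries ℕ+ ℂ)) = 0 := by
  rw [schur_eq_schurSeq (le_max_right B.card (μ.colLen 0)), schurSeq_eq_pDet, aSeq_eq_ofFn,
    evalX_dList_pDet]
  refine Finset.sum_eq_zero fun φ _ => ?_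
  by_contra hne
  exact hns (sameTail_of_forall hk (le_max_left _ _) (le_max_right _ _)
    (tail_of_hDet_ne_zero (rowLen_antitone μ) (lamPart_le_rowLen hμ) _ φ
      (sum_aFun (le_max_left _ _)).le hne).1)

theorem evalX_dList_schur_of_sameTail {B : Finset ℕ} {k : ℕ} (hk : k ≤ B.card)
    {μ : YoungDiagram} (hμ : lam B ≤ μ) (hs : SameTail B k μ) :
    evalX k (dList (aSeq B k) (schur μ : MvPowerSeries ℕ+ ℂ)) =
      (((cSign B k : ℤˣ) : ℤ) : ℂ) • evalX k (schurSeq k μ.rowLen : MvPowerSeries ℕ+ ℂ) := by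
  have hm := mNum_le B k
  have hrow : ∀ r : Fin B.card, k ≤ (r : ℕ) →
      (μ.rowLen r : ℤ) - (r : ℕ) = gap B (B.card - 1 - r) - (B.card - 1 : ℤ) := by
    intro r hr
    rw [hs.2 r hr r.2, rowLen_lam, lamPart_sub r.2]
  rw [schur_eq_schurSeq hs.1, schurSeq_eq_pDet, aSeq_eq_ofFn, evalX_dList_pDet,
    Finset.sum_eq_single (tailRows B k)]
  · have hdec0 : ∀ r : Fin B.card, ((r : ℕ) < k ∨ k + mNum B k ≤ (r : ℕ)) →
        rowDec (aFun B k) (tailRows B k) r = 0 := by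
      intro r hr
      by_contra hne
      obtain ⟨l, rfl⟩ := exists_of_rowDec_ne_zero hne
      simp only [tailRows] at hr
      omega
    rw [hDet_of_tail_perm (show k + (B.card - k) = B.card by omega) _
      ((topRowEquiv B k).trans Fin.revPerm)]
    -- `cSign` is defined with the inverse of `topRowEquiv`, which has the same sign.
    · rw [schurSeq_eq_pDet, evalX_pDet, cSign, Equiv.Perm.sign_trans, Equiv.Perm.sign_trans,
        Equiv.Perm.sign_symm, Int.cast_smul_eq_zsmul]
      congr 2
      funext i
      simp only [Pi.sub_apply]
      rw [hdec0 _ (Or.inl i.2), sub_zero]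
    · intro l
      rw [Pi.sub_apply, hrow _ (Nat.le_add_right k l)]
      have hv : ((((topRowEquiv B k).trans Fin.revPerm) l : Fin (B.card - k)) : ℕ) =
          B.card - k - (topRow B k l + 1) := by
        simp [topRowEquiv, Fin.val_rev]
      have hlt := topRow_lt (B := B) (k := k) l.2
      rw [hv]
      by_cases hl : (l : ℕ) < mNum B k
      · have h1 := rowDec_apply_of_injective (aFun B k) (tailRows_injective B k) ⟨l, hl⟩
        have h2 : tailRows B k ⟨l, hl⟩ = ⟨k + l, by omega⟩ := rfl
        have h3 := aFun_add_nongap (B := B) (k := k) ⟨l, hl⟩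
        have h4 : topRow B k l = nongap B l := if_pos hl
        rw [h2] at h1
        rw [h1]
        simp only at h3 ⊢
        rw [show B.card - 1 - (k + (l : ℕ)) = B.card - k - 1 - l by omega]
        omega
      · have h4 : topRow B k l = gap B (B.card - k - 1 - l) := if_neg hl
        rw [hdec0 _ (Or.inr (show k + mNum B k ≤ k + (l : ℕ) by omega))]
        simp only
        rw [show B.card - 1 - (k + (l : ℕ)) = B.card - k - 1 - l by omega]
        omega
  · intro φ _ hφ
    by_contra hne
    obtain ⟨-, -, σ, hσ, hval⟩ := tail_of_hDet_ne_zero (rowLen_antitone μ) (lamPart_le_rowLen hμ)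
      _ φ (sum_aFun le_rfl).le hne
    have hv : ∀ r : Fin B.card, k ≤ (r : ℕ) →
        k ≤ (σ.symm r : ℕ) ∧ (gap B (B.card - 1 - r) : ℤ) - rowDec (aFun B k) φ r =
          B.card - 1 - (σ.symm r : ℕ) := by
      intro r hr
      have h1 : k ≤ (σ.symm r : ℕ) := (hσ _).2 (by simpa using hr)
      have h2 := hval _ h1
      rw [Equiv.apply_symm_apply, hrow r hr] at h2
      exact ⟨h1, by linarith⟩
    refine hφ (eq_tailRows φ (fun r hr => ?_) fun r r' hr hr' h => ?_)
    · have h1 := hv r hr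
      have h2 := (σ.symm r).2
      omega
    · rw [(hv r hr).2, (hv r' hr').2] at h
      exact σ.symm.injective (Fin.ext (by omega))
  · simp

theorem card_lam {B : Finset ℕ} {N : ℕ} (hN : B.card ≤ N) :
    (lam B).card = ∑ r : Fin N, lamPart B r := by
  classical
  rw [YoungDiagram.card, lam, Finset.card_biUnion]
  · rw [Fin.sum_univ_eq_sum_range (fun r => lamPart B r),
      ← Finset.sum_subset (Finset.range_subset_range.2 hN)]
    · refine Finset.sum_congr rfl fun i _ => ?_
      rw [Finset.card_image_of_injective _ fun a b h => by simpa using h, Finset.card_range]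
    · intro r _ hr
      rw [Finset.mem_range] at hr
      exact lamPart_of_le (by omega)
  · intro i _ j _ hij
    refine Finset.disjoint_left.2 ?_
    rintro ⟨a, b⟩ h1 h2
    simp only [Finset.mem_image, Prod.mk.injEq] at h1 h2
    obtain ⟨_, _, rfl, _⟩ := h1
    obtain ⟨_, _, h, _⟩ := h2
    exact hij h.symm

/-- At `k = 0` all row values are prescribed. Summing them shows that a surviving term needs the
weight of `I` to equal `|μ| ≥ |λ|`. -/
theorem evalX_dList_schur_of_sum_lt {B : Finset ℕ} {I : List ℕ+}
    (hI : (I.map fun i : ℕ+ => (i : ℕ)).sum < (lam B).card) {μ : YoungDiagram}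
    (hμ : lam B ≤ μ) : evalX 0 (dList I (schur μ : MvPowerSeries ℕ+ ℂ)) = 0 := by
  rw [schur_eq_schurSeq (le_max_right B.card (μ.colLen 0)), schurSeq_eq_pDet,
    ← List.ofFn_get I, evalX_dList_pDet]
  refine Finset.sum_eq_zero fun φ _ => ?_
  by_contra hne
  obtain ⟨σ, hσ⟩ := exists_perm_of_hDet_ne_zero hne
  have h1 := Finset.sum_congr rfl fun j (_ : j ∈ Finset.univ) => hσ j (Nat.zero_le _)
  rw [Equiv.sum_comp σ] at h1
  simp only [Pi.sub_apply] at h1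
  rw [Finset.sum_sub_distrib, Finset.sum_sub_distrib, sum_rowDec, Finset.sum_neg_distrib] at h1
  have h2 : ∑ l, ((I.get l : ℕ) : ℤ) = ((I.map fun i : ℕ+ => (i : ℕ)).sum : ℕ) := by
    rw [← Nat.cast_sum]
    congr 1
    conv_rhs => rw [← List.ofFn_get I, List.map_ofFn, List.sum_ofFn]
    rfl
  have h3 : ((lam B).card : ℤ) ≤ ∑ r : Fin (max B.card (μ.colLen 0)), (μ.rowLen r : ℤ) := by
    rw [card_lam (le_max_left B.card (μ.colLen 0)), Nat.cast_sum]
    exact Finset.sum_le_sum fun r _ => by exact_mod_cast lamPart_le_rowLen hμ r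
  omega

/-- Each of the first `m_0` rows starts at a positive index but must end at a value at most `0`, so
it is hit by some derivative. -/
theorem evalX_dList_schur_of_length_lt {B : Finset ℕ} {I : List ℕ+}
    (hI : I.length < mNum B 0) {μ : YoungDiagram}
    (hμ : lam B ≤ μ) : evalX 0 (dList I (schur μ : MvPowerSeries ℕ+ ℂ)) = 0 := by
  rw [schur_eq_schurSeq (le_max_right B.card (μ.colLen 0)), schurSeq_eq_pDet,
    ← List.ofFn_get I, evalX_dList_pDet]
  refine Finset.sum_eq_zero fun φ _ => ?_
  by_contra hne
  obtain ⟨σ, hσ⟩ := exists_perm_of_hDet_ne_zero hne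
  have hm := mNum_le B 0
  have hN := le_max_left B.card (μ.colLen 0)
  have hhit : ∀ r : Fin (mNum B 0), ∃ l, φ l = ⟨r, by omega⟩ := by
    intro r
    refine exists_of_rowDec_ne_zero (I := I.get) fun h0 => ?_
    have h1 := hσ (σ.symm ⟨r, by omega⟩) (Nat.zero_le _)
    rw [Equiv.apply_symm_apply, Pi.sub_apply, h0] at h1
    have h2 := lamPart_le_rowLen hμ r
    have h3 := lamPart_sub (B := B) (r := r) (by omega)
    have h4 := le_gap (B := B) (k := 0) (i := B.card - 1 - r) (by omega) (by omega)
    simp only at h1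
    omega
  choose ψ hψ using hhit
  have hinj : Function.Injective ψ := fun i j h => by
    have := (hψ i).symm.trans ((congrArg φ h).trans (hψ j))
    simp only [Fin.mk.injEq] at this
    exact Fin.ext this
  have := Fintype.card_le_of_injective ψ hinj
  simp only [Fintype.card_fin] at this
  omega

/-! ### Leading term in the last variable -/

theorem X_dvd_hDet_succ_sub (n : ℕ) {N : ℕ} (b : Fin N → ℤ) :
    (MvPowerSeries.X n : MvPowerSeries ℕ ℂ) ∣ hDet (n + 1) b - hDet n b := by
  rw [← Ideal.mem_span_singleton, ← Ideal.Quotient.eq, hDet, hDet, RingHom.map_det,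
    RingHom.map_det]
  congr 1
  ext1 i j
  simp only [RingHom.mapMatrix_apply, Matrix.map_apply, Matrix.of_apply]
  rw [Ideal.Quotient.eq, Ideal.mem_span_singleton, ← hSym_succ_sub n]
  exact ⟨hSym (n + 1) (b i + (j : ℕ) - 1), by ring⟩

/-- The leading term of a Schur function in the last variable. -/
theorem X_pow_dvd_evalX_schurSeq_sub (n : ℕ) {f : ℕ → ℕ} (hf : Antitone f) :
    (MvPowerSeries.X n : MvPowerSeries ℕ ℂ) ^ (f n + 1) ∣
      evalX (n + 1) (schurSeq (n + 1) f : MvPowerSeries ℕ+ ℂ) -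
        evalX n (schurSeq n f : MvPowerSeries ℕ+ ℂ) * MvPowerSeries.X n ^ (f n) := by
  rw [schurSeq_eq_pDet, schurSeq_eq_pDet, evalX_pDet, evalX_pDet]
  -- Using `eSeries n` with `n + 1` variables changes only the last column, whose entries become the
  -- powers `x_{n+1}^{f_i - i + n}`.
  rw [hDet, det_shift_eq n (hSym (n + 1)) (fun l => PowerSeries.coeff l (eSeries n))
    (by simpa using constantCoeff_eSeries n) (fun l => coeff_eSeries_of_lt),
    Matrix.det_succ_column _ (Fin.last n), Fin.sum_univ_castSucc, add_sub_assoc]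
  simp only [sum_hSym_mul_coeff, coeff_hSeries_succ_mul_eSeries, Matrix.of_apply]
  refine dvd_add (Finset.dvd_sum fun i _ => ?_) ?_
  -- For `i < n` the exponent is at least `f n + 1`, so only the corner entry contributes to the
  -- leading term.
  · refine Dvd.dvd.mul_right (Dvd.dvd.mul_left ?_ _) _
    have h1 := hf i.2.le
    simp only [Fin.val_last, lt_irrefl, if_false, Fin.val_castSucc]
    rw [if_pos (by omega)]
    exact pow_dvd_pow _ (by omega)
  · simp only [Fin.val_last, lt_irrefl, if_false]
    rw [if_pos (by omega), show ((f n : ℤ) - (n : ℕ) + (n : ℕ)).toNat = f n by omega, ← two_mul,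
      pow_mul, neg_one_sq, one_pow, one_mul, mul_comm (hDet _ _), ← mul_sub, pow_succ]
    refine mul_dvd_mul_left _ ?_
    convert X_dvd_hDet_succ_sub n (fun i : Fin n => (f i : ℤ) - (i : ℕ)) using 2
    rw [hDet]
    congr 1
    ext1 i j
    simp

/-! ### Linear maps determined by finitely many coefficients -/

/-- Each coefficient of `T f` depends on finitely many coefficients of `f` only. -/
def ColumnFinite {σ τ : Type*} (T : MvPowerSeries σ ℂ →ₗ[ℂ] MvPowerSeries τ ℂ) : Prop :=
  ∀ e, ∃ D : Finset (σ →₀ ℕ), ∀ f, (∀ d ∈ D, MvPowerSeries.coeff d f = 0) →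
    MvPowerSeries.coeff e (T f) = 0

theorem ColumnFinite.comp {σ τ υ : Type*} {T : MvPowerSeries σ ℂ →ₗ[ℂ] MvPowerSeries τ ℂ}
    {T' : MvPowerSeries τ ℂ →ₗ[ℂ] MvPowerSeries υ ℂ} (h' : ColumnFinite T')
    (h : ColumnFinite T) : ColumnFinite (T' ∘ₗ T) := by
  classical
  intro e
  obtain ⟨D, hD⟩ := h' e
  choose E hE using h
  exact ⟨D.biUnion E, fun f hf => hD _ fun d hd =>
    hE d f fun c hc => hf c (Finset.mem_biUnion.2 ⟨d, hd, hc⟩)⟩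

theorem ColumnFinite.id {σ : Type*} :
    ColumnFinite (LinearMap.id : MvPowerSeries σ ℂ →ₗ[ℂ] MvPowerSeries σ ℂ) :=
  fun e => ⟨{e}, fun _ hf => hf e (Finset.mem_singleton_self e)⟩

theorem columnFinite_pderiv {σ : Type*} (i : σ) :
    ColumnFinite (MvPowerSeries.pderiv ℂ i : MvPowerSeries σ ℂ →ₗ[ℂ] MvPowerSeries σ ℂ) := by
  intro e
  refine ⟨{e + Finsupp.single i 1}, fun f hf => ?_⟩
  have := hf _ (Finset.mem_singleton_self _)
  rw [Derivation.coeFn_coe, MvPowerSeries.coeff_pderiv, this, zero_mul]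

theorem columnFinite_mulRight {σ : Type*} (G : MvPowerSeries σ ℂ) :
    ColumnFinite (LinearMap.mulRight ℂ G) := by
  classical
  intro e
  refine ⟨(Finset.HasAntidiagonal.antidiagonal e).image Prod.fst, fun f hf => ?_⟩
  rw [LinearMap.mulRight_apply, MvPowerSeries.coeff_mul]
  refine Finset.sum_eq_zero fun x hx => ?_
  rw [hf _ (Finset.mem_image_of_mem _ hx), zero_mul]

/-- `dList` as a linear map. -/
def dListLin (I : List ℕ+) : MvPowerSeries ℕ+ ℂ →ₗ[ℂ] MvPowerSeries ℕ+ ℂ :=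
  I.foldr (fun i T => (MvPowerSeries.pderiv ℂ i : _ →ₗ[ℂ] MvPowerSeries ℕ+ ℂ) ∘ₗ T)
    LinearMap.id

theorem dListLin_apply (I : List ℕ+) (f : MvPowerSeries ℕ+ ℂ) : dListLin I f = dList I f := by
  induction I with
  | nil => rfl
  | cons i I ih =>
    change MvPowerSeries.pderiv ℂ i (dListLin I f) = MvPowerSeries.pderiv ℂ i (dList I f)
    rw [ih]

theorem columnFinite_dListLin (I : List ℕ+) : ColumnFinite (dListLin I) := by
  induction I with
  | nil => exact ColumnFinite.id
  | cons i I ih => exact (columnFinite_pderiv i).comp ih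

/-- `evalX` as a linear map. -/
def evalXLin (k : ℕ) : MvPowerSeries ℕ+ ℂ →ₗ[ℂ] MvPowerSeries ℕ ℂ :=
  (MvPowerSeries.substAlgHom (R := ℂ) (hasSubst_xPoint k)).toLinearMap

theorem evalXLin_apply (k : ℕ) (f : MvPowerSeries ℕ+ ℂ) : evalXLin k f = evalX k f :=
  MvPowerSeries.substAlgHom_apply (hasSubst_xPoint k) f

theorem columnFinite_evalXLin (k : ℕ) : ColumnFinite (evalXLin k) := by
  intro e
  have hfin : (Function.support fun d : ℕ+ →₀ ℕ =>
      MvPowerSeries.coeff e (d.prod fun s c => xPoint k s ^ c)).Finite := by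
    -- The series with all coefficients `1` yields a finite set of exponents independent of `f`.
    have h := MvPowerSeries.coeff_subst_finite (hasSubst_xPoint k)
      (fun _ => 1 : MvPowerSeries ℕ+ ℂ) e
    have h1 : ∀ d, MvPowerSeries.coeff d (fun _ => 1 : MvPowerSeries ℕ+ ℂ) = 1 := fun _ => rfl
    simp only [h1, one_smul] at h
    exact h
  refine ⟨hfin.toFinset, fun f hf => ?_⟩
  rw [evalXLin_apply, evalX, MvPowerSeries.coeff_subst (hasSubst_xPoint k)]
  refine finsum_eq_zero_of_forall_eq_zero fun d => ?_
  by_cases hd : d ∈ hfin.toFinset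
  · rw [hf d hd, zero_smul]
  · rw [Set.Finite.mem_toFinset, Function.notMem_support] at hd
    rw [hd, smul_zero]

open Classical in
/-- A column-finite map may be applied to a formal sum termwise. -/
theorem ColumnFinite.coeff_formalSum {τ : Type*}
    {T : MvPowerSeries ℕ+ ℂ →ₗ[ℂ] MvPowerSeries τ ℂ} (hT : ColumnFinite T)
    {P : YoungDiagram → Prop} (ξ : YoungDiagram → ℂ) {s : YoungDiagram → MvPolynomial ℕ+ ℂ}
    (hs : ∀ d, {μ | P μ ∧ MvPolynomial.coeff d (s μ) ≠ 0}.Finite) (e : τ →₀ ℕ) :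
    ∃ M : Finset YoungDiagram, ∀ M', M ⊆ M' →
      MvPowerSeries.coeff e (T (formalSum P ξ s)) =
        ∑ μ ∈ M', if P μ then ξ μ * MvPowerSeries.coeff e (T (s μ)) else 0 := by
  obtain ⟨D, hD⟩ := hT e
  -- Allowing every `M' ⊇ M` lets two formal sums be compared over one common finite set.
  refine ⟨D.biUnion fun d => (hs d).toFinset, fun M' hM' => ?_⟩
  have key := hD (formalSum P ξ s - ∑ μ ∈ M', if P μ then ξ μ • (s μ : MvPowerSeries ℕ+ ℂ) else 0)
    fun d hd => by
      rw [map_sub, sub_eq_zero, map_sum]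
      change ∑ᶠ (μ : YoungDiagram) (_ : P μ), ξ μ * MvPolynomial.coeff d (s μ) = _
      simp only [finsum_eq_if]
      rw [finsum_eq_sum_of_support_subset _ (s := M')]
      · refine Finset.sum_congr rfl fun μ _ => ?_
        split_ifs <;> simp
      · intro μ hμ
        refine hM' (Finset.mem_biUnion.2 ⟨d, hd, ?_⟩)
        rw [Set.Finite.mem_toFinset]
        by_contra hn
        apply hμ
        simp only [Set.mem_ofPred_eq, not_and, not_not] at hn
        simp only
        split_ifs with hP
        · rw [hn hP, mul_zero]
        · rfl
  rw [map_sub, map_sub, sub_eq_zero, map_sum, map_sum] at key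
  rw [key]
  refine Finset.sum_congr rfl fun μ _ => ?_
  split_ifs <;> simp

theorem schur_coeff_finite' (P : YoungDiagram → Prop) (d : ℕ+ →₀ ℕ) :
    {μ | P μ ∧ MvPolynomial.coeff d (schur μ) ≠ 0}.Finite :=
  (schur_coeff_finite d).subset fun _ h => h.2

theorem schurSeq_coeff_finite' (B : Finset ℕ) (k : ℕ) (d : ℕ+ →₀ ℕ) :
    {μ : YoungDiagram | (lam B < μ ∧ SameTail B k μ) ∧
      MvPolynomial.coeff d (schurSeq k μ.rowLen) ≠ 0}.Finite :=
  (schurSeq_coeff_finite B k d).subset fun _ h => ⟨h.1.2, h.2⟩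

/-! ### The series `τ` -/

theorem sameTail_lam (B : Finset ℕ) (k : ℕ) : SameTail B k (lam B) := by
  refine ⟨?_, fun _ _ _ => rfl⟩
  by_contra h
  have : (B.card, 0) ∈ lam B := YoungDiagram.mem_iff_lt_colLen.2 (by omega)
  have := YoungDiagram.mem_iff_lt_rowLen.1 this
  rw [rowLen_lam, lamPart_of_le le_rfl] at this
  omega

theorem evalX_dList_tau {B : Finset ℕ} (ξ : YoungDiagram → ℂ) {k : ℕ} (hk : k ≤ B.card) :
    evalX k (dList (aSeq B k) (tau B ξ)) =
      (((cSign B k : ℤˣ) : ℤ) : ℂ) • evalX k (tauTrunc B ξ k) := by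
  classical
  rw [← dListLin_apply, ← evalXLin_apply, ← evalXLin_apply]
  ext1 e
  have hc := (columnFinite_evalXLin k).comp (columnFinite_dListLin (aSeq B k))
  obtain ⟨M, hM⟩ := hc.coeff_formalSum ξ (schur_coeff_finite' fun μ => lam B < μ) e
  obtain ⟨M', hM'⟩ := (columnFinite_evalXLin k).coeff_formalSum ξ (schurSeq_coeff_finite' B k) e
  have h1 := hM (M ∪ M') Finset.subset_union_left
  have h2 := hM' (M ∪ M') Finset.subset_union_right
  simp only [LinearMap.comp_apply] at h1
  rw [tau, tauTrunc, map_add, map_add, map_add, map_add, smul_add, map_add, h1,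
    MvPowerSeries.coeff_smul (evalXLin k (formalSum _ _ _)), h2, dListLin_apply, evalXLin_apply,
    evalXLin_apply, evalX_dList_schur_of_sameTail hk le_rfl (sameTail_lam B k), Finset.mul_sum]
  congr 1
  refine Finset.sum_congr rfl fun μ _ => ?_
  by_cases hlt : lam B < μ
  · rw [if_pos hlt, dListLin_apply, evalXLin_apply, evalXLin_apply]
    by_cases hs : SameTail B k μ
    · rw [if_pos ⟨hlt, hs⟩, evalX_dList_schur_of_sameTail hk hlt.le hs, MvPowerSeries.coeff_smul]
      ring
    · rw [if_neg fun h => hs h.2, evalX_dList_schur_of_not_sameTail hk hlt.le hs, map_zero]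
      ring
  · rw [if_neg hlt, if_neg fun h => hlt h.1, mul_zero]

theorem evalX_dList_tau_eq_zero {B : Finset ℕ} (ξ : YoungDiagram → ℂ) {k : ℕ} {I : List ℕ+}
    (h : ∀ μ, lam B ≤ μ → evalX k (dList I (schur μ : MvPowerSeries ℕ+ ℂ)) = 0) :
    evalX k (dList I (tau B ξ)) = 0 := by
  classical
  rw [← dListLin_apply, ← evalXLin_apply]
  ext1 e
  have hc := (columnFinite_evalXLin k).comp (columnFinite_dListLin I)
  obtain ⟨M, hM⟩ := hc.coeff_formalSum ξ (schur_coeff_finite' fun μ => lam B < μ) e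
  have h1 := hM M subset_rfl
  simp only [LinearMap.comp_apply] at h1
  rw [tau, map_add, map_add, map_add, h1, dListLin_apply, evalXLin_apply, h _ le_rfl, map_zero,
    zero_add]
  refine Finset.sum_eq_zero fun μ _ => ?_
  split_ifs with hlt
  · rw [dListLin_apply, evalXLin_apply, h μ hlt.le, map_zero, mul_zero]
  · rfl

theorem sameTail_iff_succ {B : Finset ℕ} {n : ℕ} (hn : n < B.card) {μ : YoungDiagram} :
    SameTail B n μ ↔ SameTail B (n + 1) μ ∧ μ.rowLen n = (lam B).rowLen n := by
  refine ⟨fun h => ⟨⟨h.1, fun i hi => h.2 i (by omega)⟩, h.2 n le_rfl hn⟩,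
    fun h => ⟨h.1.1, fun i hi hi' => ?_⟩⟩
  rcases hi.eq_or_lt with rfl | hlt
  · exact h.2
  · exact h.1.2 i hlt hi'

/-- A diagram with `μ_{n+1} > λ_{n+1}` contributes only to order `x_{n+1}^{λ_{n+1}+1}`. Those with
equality are the ones occurring in `τ^{(n)}`, and contribute their leading terms. -/
theorem eqModX_evalX_tauTrunc {B : Finset ℕ} (ξ : YoungDiagram → ℂ) {n : ℕ} (hn : n < B.card) :
    EqModX (n + 1) ((lam B).rowLen n + 1) (evalX (n + 1) (tauTrunc B ξ (n + 1)))
      (evalX n (tauTrunc B ξ n) * MvPowerSeries.X n ^ (lam B).rowLen n) := by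
  classical
  rw [EqModX, Nat.add_sub_cancel, MvPowerSeries.X_pow_dvd_iff]
  intro e he
  set G : MvPowerSeries ℕ ℂ := MvPowerSeries.X n ^ (lam B).rowLen n with hG
  have hlead : ∀ μ : YoungDiagram, μ.rowLen n = (lam B).rowLen n →
      MvPowerSeries.coeff e (evalX (n + 1) (schurSeq (n + 1) μ.rowLen : MvPowerSeries ℕ+ ℂ)) =
        MvPowerSeries.coeff e (evalX n (schurSeq n μ.rowLen : MvPowerSeries ℕ+ ℂ) * G) := by
    intro μ hμ
    have h := X_pow_dvd_evalX_schurSeq_sub n (rowLen_antitone μ)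
    rw [hμ] at h
    have h1 := MvPowerSeries.X_pow_dvd_iff.1 h e he
    rwa [map_sub, sub_eq_zero] at h1
  have hhigh : ∀ μ : YoungDiagram, (lam B).rowLen n < μ.rowLen n →
      MvPowerSeries.coeff e (evalX (n + 1) (schurSeq (n + 1) μ.rowLen : MvPowerSeries ℕ+ ℂ)) =
        0 := by
    intro μ hμ
    have h := X_pow_dvd_evalX_schurSeq_sub n (rowLen_antitone μ)
    -- Lowering the exponent by one makes the subtracted leading term divisible as well, so the
    -- Schur function itself is.
    have h1 := ((pow_dvd_pow (MvPowerSeries.X n : MvPowerSeries ℕ ℂ)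
      (Nat.le_succ (μ.rowLen n))).trans h)
    rw [dvd_sub_left (Dvd.intro_left _ rfl)] at h1
    exact MvPowerSeries.X_pow_dvd_iff.1 h1 e (by omega)
  have hc := (columnFinite_mulRight G).comp (columnFinite_evalXLin n)
  obtain ⟨M, hM⟩ := (columnFinite_evalXLin (n + 1)).coeff_formalSum ξ
    (schurSeq_coeff_finite' B (n + 1)) e
  obtain ⟨M', hM'⟩ := hc.coeff_formalSum ξ (schurSeq_coeff_finite' B n) e
  have h1 := hM (M ∪ M') Finset.subset_union_left
  have h2 := hM' (M ∪ M') Finset.subset_union_right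
  simp only [LinearMap.comp_apply, LinearMap.mulRight_apply] at h2
  rw [← evalXLin_apply, ← evalXLin_apply, tauTrunc, tauTrunc, map_sub, map_add, map_add, map_add,
    add_mul, map_add, h1, h2, evalXLin_apply, evalXLin_apply, hlead _ rfl, sub_eq_zero]
  congr 1
  refine Finset.sum_congr rfl fun μ _ => ?_
  rw [sameTail_iff_succ hn, evalXLin_apply, evalXLin_apply]
  by_cases hlt : lam B < μ ∧ SameTail B (n + 1) μ
  · rw [if_pos hlt]
    by_cases hrow : μ.rowLen n = (lam B).rowLen n
    · rw [if_pos ⟨hlt.1, hlt.2, hrow⟩, hlead μ hrow]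
    · rw [if_neg fun h => hrow h.2.2,
        hhigh μ (lt_of_le_of_ne (rowLen_mono hlt.1.le n) (Ne.symm hrow)), mul_zero]
  · rw [if_neg hlt, if_neg fun h => hlt ⟨h.1, h.2.1⟩]

/-! ### The case `k = 0` -/

theorem constantCoeff_evalX_zero (f : MvPowerSeries ℕ+ ℂ) :
    MvPowerSeries.constantCoeff (evalX 0 f) = MvPowerSeries.constantCoeff f := by
  have h : xPoint 0 = fun _ => 0 := by
    funext n
    simp [xPoint]
  rw [evalX, MvPowerSeries.constantCoeff_subst (hasSubst_xPoint 0), finsum_eq_single _ 0]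
  · simp
  · intro d hd
    obtain ⟨i, hi⟩ := Finsupp.ne_iff.1 hd
    rw [Finsupp.prod, Finset.prod_eq_zero (Finsupp.mem_support_iff.2 hi), map_zero, smul_zero]
    rw [h]
    exact zero_pow hi

/-- A diagram sharing all its rows with `λ` is `λ`, so no `μ > λ` occurs. -/
theorem tauTrunc_zero (B : Finset ℕ) (ξ : YoungDiagram → ℂ) : tauTrunc B ξ 0 = 1 := by
  have h : formalSum (fun μ => lam B < μ ∧ SameTail B 0 μ) ξ (fun μ => schurSeq 0 μ.rowLen) =
      0 := by
    funext d
    refine finsum_eq_zero_of_forall_eq_zero fun μ => ?_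
    classical
    rw [finsum_eq_if, if_neg]
    rintro ⟨hlt, hs⟩
    refine absurd (ext_rowLen fun i => ?_) hlt.ne
    rcases lt_or_ge i B.card with hi | hi
    · exact (hs.2 i (Nat.zero_le i) hi).symm
    · rw [rowLen_eq_zero (hs.1.trans hi), rowLen_eq_zero ((sameTail_lam B 0).1.trans hi)]
  rw [tauTrunc, h, add_zero, schurSeq, Matrix.det_isEmpty, MvPolynomial.coe_one]

end

end GapTau

theorem mainTheorem9 (B : Finset ℕ) (ξ : YoungDiagram → ℂ) :
    (∀ k : ℕ, k < B.card → 0 < GapTau.mNum B k →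
      GapTau.evalX k (GapTau.dList (GapTau.aSeq B k) (GapTau.tau B ξ)) =
        (((GapTau.cSign B k : ℤˣ) : ℤ) : ℂ) • GapTau.evalX k (GapTau.tauTrunc B ξ k)) ∧
    (∀ k : ℕ, 1 ≤ k → k < B.card → 0 < GapTau.mNum B k →
      GapTau.EqModX k ((GapTau.lam B).rowLen (k - 1) + 1)
        (GapTau.evalX k (GapTau.tauTrunc B ξ k))
        (GapTau.evalX (k - 1) (GapTau.tauTrunc B ξ (k - 1)) *
          MvPowerSeries.X (k - 1) ^ (GapTau.lam B).rowLen (k - 1))) ∧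
    (∀ k : ℕ, 1 ≤ k → k < B.card → 0 < GapTau.mNum B k →
      GapTau.EqModX k ((GapTau.lam B).rowLen (k - 1) + 1)
        (GapTau.evalX k (GapTau.dList (GapTau.aSeq B k) (GapTau.tau B ξ)))
        (((((GapTau.cSign B k : ℤˣ) : ℤ) : ℂ) / (((GapTau.cSign B (k - 1) : ℤˣ) : ℤ) : ℂ)) •
          (GapTau.evalX (k - 1) (GapTau.dList (GapTau.aSeq B (k - 1)) (GapTau.tau B ξ)) *
            MvPowerSeries.X (k - 1) ^ (GapTau.lam B).rowLen (k - 1)))) ∧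
    (∀ I : List ℕ+, (I.map fun i : ℕ+ => (i : ℕ)).sum < (GapTau.lam B).card →
      MvPowerSeries.constantCoeff (GapTau.dList I (GapTau.tau B ξ)) = 0) ∧
    (∀ I : List ℕ+, I.length < GapTau.mNum B 0 →
      MvPowerSeries.constantCoeff (GapTau.dList I (GapTau.tau B ξ)) = 0) ∧
    MvPowerSeries.constantCoeff (GapTau.dList (GapTau.aSeq B 0) (GapTau.tau B ξ)) =
      (((GapTau.cSign B 0 : ℤˣ) : ℤ) : ℂ) := by
  refine ⟨fun k hk _ => GapTau.evalX_dList_tau ξ hk.le, fun k h1 hk _ => ?_,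
    fun k h1 hk _ => ?_, fun I hI => ?_, fun I hI => ?_, ?_⟩
  · obtain ⟨n, rfl⟩ : ∃ n, k = n + 1 := ⟨k - 1, by omega⟩
    exact GapTau.eqModX_evalX_tauTrunc ξ (by omega)
  · obtain ⟨n, rfl⟩ : ∃ n, k = n + 1 := ⟨k - 1, by omega⟩
    have h := GapTau.eqModX_evalX_tauTrunc (B := B) ξ (n := n) (by omega)
    -- Applying (A)(i) at `k` and at `k - 1` cancels `c_{k-1}` and leaves `c_k` times (A)(ii).
    rw [Nat.add_sub_cancel, GapTau.evalX_dList_tau ξ hk.le,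
      GapTau.evalX_dList_tau ξ (show n ≤ B.card by omega), smul_mul_assoc, smul_smul,
      div_mul_cancel₀ _ (by simp)]
    rw [GapTau.EqModX] at h ⊢
    rw [← smul_sub]
    exact h.trans ⟨MvPowerSeries.C (((GapTau.cSign B (n + 1) : ℤˣ) : ℤ) : ℂ), by
      rw [MvPowerSeries.smul_eq_C_mul, mul_comm (MvPowerSeries.C _)]⟩
  · rw [← GapTau.constantCoeff_evalX_zero, GapTau.evalX_dList_tau_eq_zero ξ
      fun μ hμ => GapTau.evalX_dList_schur_of_sum_lt hI hμ, map_zero]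
  · rw [← GapTau.constantCoeff_evalX_zero, GapTau.evalX_dList_tau_eq_zero ξ
      fun μ hμ => GapTau.evalX_dList_schur_of_length_lt hI hμ, map_zero]
  · rw [← GapTau.constantCoeff_evalX_zero, GapTau.evalX_dList_tau ξ (Nat.zero_le _),
      MvPowerSeries.constantCoeff_smul, GapTau.constantCoeff_evalX_zero, GapTau.tauTrunc_zero]
    simp
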